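/- All graphs are finite and simple. A connected graph is called prolific if it is not a path, not a cycle and not the claw $K_{1,3}$. Let $L(G)$ be the line graph of $G$ and let $L^0(G)=G$, $L^{r}(G)=L(L^{r-1}(G))$ for $r \ge 1$. Let $\chi'(G)$ be the chromatic index of $G$ (the least number of colours in a proper edge colouring), and put $\mathrm{ind}(\chi',G)=\min\{r : \chi'(G)<\chi'(L^r(G))\}$ (with $\min\emptyset=\infty$). A subdivision of $K_{1,3}$ is of type A if its centre vertex, of degree 3, is adjacent to exactly two leaves. Let $S_{2,2}$ be the double star, that is, the tree formed by two adjacent vertices joined by the middle edge, with two leaves attached to each of them. Theorem. For every prolific graph $G$, $\mathrm{ind}(\chi',G)\le 3$. Moreover, $\mathrm{ind}(\chi',G)=3$ if and only if $G$ is $K_{1,4}$, or $G$ is a type A subdivision of $K_{1,3}$, or $G$ is obtained from $S_{2,2}$ by subdividing its middle edge at least twice (that is, replacing it by a path with at least two inner vertices). Hence, for the family $\mathcal F$ of all prolific graphs, $k(\chi',\mathcal F)=\max\{\mathrm{ind}(\chi',G) : G\in\mathcal F\}=3$. -/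

import Mathlib

universe u

namespace LineGraphIndex

/-- A finite connected simple graph that is neither a path, nor a cycle, nor the claw `K_{1,3}`. -/
structure IsProlific {V : Type u} (G : SimpleGraph V) : Prop where
  finite : Finite V
  connected : G.Connected
  not_path : ∀ n : ℕ, IsEmpty (G ≃g SimpleGraph.pathGraph n)
  not_cycle : ∀ n : ℕ, 3 ≤ n → IsEmpty (G ≃g SimpleGraph.cycleGraph n)
  not_claw : IsEmpty (G ≃g completeBipartiteGraph (Fin 1) (Fin 3))

/-- `G` has a proper edge colouring with `n` colours: distinct edges with a common endpoint
receive different colours. -/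
def EdgeColorable {V : Type u} (G : SimpleGraph V) (n : ℕ) : Prop :=
  ∃ c : G.EdgeLabeling (Fin n), ∀ e f : G.edgeSet,
    e ≠ f → (∃ v : V, v ∈ (e : Sym2 V) ∧ v ∈ (f : Sym2 V)) → c e ≠ c f

/-- The chromatic index: the least number of colours in a proper edge colouring
(`⊤` if no finite number suffices, which does not happen for finite graphs). -/
noncomputable def chromaticIndex {V : Type u} (G : SimpleGraph V) : ℕ∞ :=
  ⨅ (n : ℕ) (_ : EdgeColorable G n), (n : ℕ∞)

/-- The iterated line graph `L^k(G)` together with its vertex type: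
`L^0(G) = G` and `L^{k+1}(G) = L(L^k(G))`. -/
def iterLineGraph {V : Type u} (G : SimpleGraph V) : ℕ → (W : Type u) × SimpleGraph W
  | 0 => ⟨V, G⟩
  | k + 1 => ⟨(iterLineGraph G k).2.edgeSet, (iterLineGraph G k).2.lineGraph⟩

/-- `ind(P, G) = min {r : P(G) < P(L^r(G))}`, which is `⊤` if there is no such `r`. -/
noncomputable def ind (P : (W : Type u) → SimpleGraph W → ℕ∞) {V : Type u}
    (G : SimpleGraph V) : ℕ∞ :=
  ⨅ (r : ℕ) (_ : P V G < P (iterLineGraph G r).1 (iterLineGraph G r).2), (r : ℕ∞)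

/-- `k(P, F) = max {ind(P, G) : G ∈ F}` in `ℕ∞`. (A supremum in `ℕ∞` that is a positive
natural number is attained, so this is a genuine maximum whenever it is finite and positive.) -/
noncomputable def familyIndex (P : (W : Type u) → SimpleGraph W → ℕ∞)
    (F : (W : Type u) → SimpleGraph W → Prop) : ℕ∞ :=
  ⨆ (W : Type u) (H : SimpleGraph W) (_ : F W H), ind P H

/-- The subdivision of `K_{1,3}` in which, for each `i`, the `i`-th edge is subdivided `a i` times,
that is, replaced by a path with `a i + 1` edges. The centre is `none`, and the vertices of the
`i`-th path other than the centre are `some ⟨i, 0⟩, …, some ⟨i, a i⟩`, going outwards. -/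
def clawSubdivision (a : Fin 3 → ℕ) : SimpleGraph (Option ((i : Fin 3) × Fin (a i + 1))) :=
  SimpleGraph.fromRel fun x y =>
    match x, y with
    | none, some q => q.2.val = 0
    | some p, some q => p.1 = q.1 ∧ p.2.val + 1 = q.2.val
    | _, none => False

/-- A subdivision of `K_{1,3}` is of type A if its centre is adjacent to exactly two leaves
(vertices of degree one). -/
def IsTypeA {V : Type u} (G : SimpleGraph V) : Prop :=
  ∃ a : Fin 3 → ℕ, Nonempty (G ≃g clawSubdivision a) ∧
    {x | (clawSubdivision a).Adj none x ∧ ((clawSubdivision a).neighborSet x).ncard = 1}.ncard = 2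

/-- The graph obtained from `H` by subdividing its edge `uv` exactly `k` times, that is, by
replacing that edge by a path `u, 0, 1, …, k - 1, v` with `k` new inner vertices. -/
def subdivideEdge {W : Type u} (H : SimpleGraph W) (u v : W) (k : ℕ) :
    SimpleGraph (W ⊕ Fin k) :=
  SimpleGraph.fromRel fun x y =>
    match x, y with
    | Sum.inl a, Sum.inl b => H.Adj a b ∧ (s(a, b) = s(u, v) → k = 0)
    | Sum.inl a, Sum.inr i => (a = u ∧ i.val = 0) ∨ (a = v ∧ i.val + 1 = k)
    | Sum.inr i, Sum.inr j => i.val + 1 = j.val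
    | Sum.inr _, Sum.inl _ => False

/-- The double star `S_{2,2}`: two adjacent centres `0` and `1`, with leaves `2, 3` attached to `0`
and leaves `4, 5` attached to `1`. Its middle edge is `01`. -/
def doubleStar22 : SimpleGraph (Fin 6) :=
  SimpleGraph.fromEdgeSet {s(0, 1), s(0, 2), s(0, 3), s(1, 4), s(1, 5)}

end LineGraphIndex

/-! Write d for degree in G. A vertex of L(G) is an edge uv and has degree d(u)+d(v)-2. A vertex of
L²(G) is a path x-u-y, of degree d(x)+2d(u)+d(y)-6. Two such paths sharing the edge ux give a vertex
of L³(G) of degree 2d(x)+4d(u)+d(y)+d(z)-14. Since χ' is at least every degree, a proper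
k-edge-colouring of G together with a vertex of degree above k in Lʳ(G) forces index at most r. The
upper bounds therefore reduce to colouring G economically.

Suppose first that the largest degree sum σ of an edge is at least 6. Greedy colouring uses σ-1
colours. If the index exceeds 2, the edges next to an edge of sum σ have sum at most 5; this
improves the colouring to σ-2 colours, and the bound on those neighbouring edges to 4. Then G is the
double star S_{2,2}, which is 3-edge-colourable and has index 1 (`ind_le_two_of_six_le`).

Otherwise all degree sums are at most 5. Either G is K_{1,4}, or its maximum degree is 3 and no two
cubic vertices are adjacent. In the latter case G is 3-edge-colourable by a Kempe argument
(`edgeColorable_three`), so index above 2 forces d(x)+2d(u)+d(y) ≤ 9 on every path x-u-y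
(`IsSparse`). Thus a cubic vertex has at least two leaf neighbours, and a vertex of degree 2 does
not have two cubic neighbours. Following a longest extension of a path from a leaf through a cubic
vertex identifies the sparse graphs as the two subdivided families (`IsSparse.classification`), and
the degree formula in L³ bounds their index by 3.

Conversely, for both families L(G) lies in two triangles joined by a path and L²(G) in two copies of
K₄ minus an edge joined by a path. Both hosts are 3-edge-colourable, because their chords form a
matching. For K_{1,4}, the graphs L and L² are K₄ and the octahedron, both 4-edge-colourable. So χ'
does not increase before the third step. -/

namespace LineGraphIndex
open SimpleGraph

/-- The degree of a vertex, as a natural cardinality. -/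
noncomputable def deg {V : Type*} (G : SimpleGraph V) (v : V) : ℕ := (G.neighborSet v).ncard

/-! ### Degrees in line graphs. -/

section Degree
variable {V : Type*} {G : SimpleGraph V}

lemma ncard_incidenceSet (v : V) : (G.incidenceSet v).ncard = deg G v := by
  classical
  exact Nat.card_congr (G.incidenceSetEquivNeighborSet v)

lemma deg_pos [Finite V] {u v : V} (h : G.Adj u v) : 0 < deg G u :=
  (Set.ncard_pos (Set.toFinite _)).2 ⟨v, h⟩

lemma image_neighborSet_lineGraph {u v : V} (h : G.Adj u v) :
    Subtype.val '' (G.lineGraph.neighborSet ⟨s(u, v), h⟩) =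
      (G.incidenceSet u ∪ G.incidenceSet v) \ {s(u, v)} := by
  ext e
  constructor
  · rintro ⟨f, hf, rfl⟩
    rw [mem_neighborSet, lineGraph_adj_iff_exists] at hf
    obtain ⟨hne, w, hw, hw'⟩ := hf
    refine ⟨?_, fun h' => hne (Subtype.ext h'.symm)⟩
    rcases Sym2.mem_iff.1 hw with rfl | rfl
    · exact Or.inl ⟨f.2, hw'⟩
    · exact Or.inr ⟨f.2, hw'⟩
  · rintro ⟨he, hne⟩
    have hE : e ∈ G.edgeSet := he.elim (fun h => h.1) (fun h => h.1)
    refine ⟨⟨e, hE⟩, ?_, rfl⟩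
    rw [mem_neighborSet, lineGraph_adj_iff_exists]
    refine ⟨fun h' => hne (congrArg Subtype.val h').symm, ?_⟩
    rcases he with he | he
    · exact ⟨u, by simp, he.2⟩
    · exact ⟨v, by simp, he.2⟩

/-- Inclusion-exclusion: the edges at `u` and those at `v` share only `uv`, which is then removed.
-/
lemma deg_lineGraph [Finite V] {u v : V} (h : G.Adj u v) :
    deg G.lineGraph ⟨s(u, v), h⟩ + 2 = deg G u + deg G v := by
  have h1 : deg G.lineGraph ⟨s(u, v), h⟩ =
      ((G.incidenceSet u ∪ G.incidenceSet v) \ {s(u, v)}).ncard := by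
    rw [← image_neighborSet_lineGraph h, Set.ncard_image_of_injective _ Subtype.val_injective, deg]
  have h2 := Set.ncard_union_add_ncard_inter (G.incidenceSet u) (G.incidenceSet v)
    (Set.toFinite _) (Set.toFinite _)
  rw [incidenceSet_inter_incidenceSet_of_adj G h, Set.ncard_singleton, ncard_incidenceSet,
    ncard_incidenceSet] at h2
  have h3 := Set.ncard_sdiff_singleton_add_one (s := G.incidenceSet u ∪ G.incidenceSet v)
    (a := s(u, v)) (Or.inl ⟨h, by simp⟩) (Set.toFinite _)
  omega

lemma lineGraph_adj_of_adj {u v w : V} (h : G.Adj u v) (h' : G.Adj u w) (hne : v ≠ w) :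
    G.lineGraph.Adj ⟨s(u, v), h⟩ ⟨s(u, w), h'⟩ := by
  rw [lineGraph_adj_iff_exists]
  refine ⟨?_, u, by simp, by simp⟩
  exact fun h => hne (Sym2.congr_right.1 (congrArg Subtype.val h))

end Degree

/-! ### Edge colourings and elementary bounds on the chromatic index. -/

section Coloring
variable {V W : Type*} {G : SimpleGraph V} {H : SimpleGraph W}

/-- Viewing edge colourings as vertex colourings of the line graph lets the greedy and Kempe
arguments work with vertices. -/
lemma edgeColorable_iff {n : ℕ} : EdgeColorable G n ↔
    ∃ c : G.edgeSet → Fin n, ∀ e f, G.lineGraph.Adj e f → c e ≠ c f := by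
  constructor
  · rintro ⟨c, hc⟩
    refine ⟨c, fun e f h => ?_⟩
    rw [lineGraph_adj_iff_exists] at h
    exact hc e f h.1 h.2
  · rintro ⟨c, hc⟩
    exact ⟨c, fun e f h h' => hc e f (lineGraph_adj_iff_exists.2 ⟨h, h'⟩)⟩

/-- Monotonicity makes it enough to embed iterated line graphs in model graphs instead of
identifying them. -/
lemma EdgeColorable.of_isContained {n : ℕ} (h : EdgeColorable H n) (hc : G ⊑ H) :
    EdgeColorable G n := by
  rw [edgeColorable_iff] at h ⊢
  obtain ⟨c, hc'⟩ := h
  obtain ⟨f⟩ := hc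
  exact ⟨fun e => c (f.lineGraph e), fun e e' he => hc' _ _ (f.lineGraph.toHom.map_adj he)⟩

/-- A proper edge colouring given by a symmetric function of the two endpoints. -/
lemma edgeColorable_of_symm {n : ℕ} (t : V → V → Fin n) (hs : ∀ x y, t x y = t y x)
    (ht : ∀ x y z, G.Adj x y → G.Adj x z → y ≠ z → t x y ≠ t x z) : EdgeColorable G n := by
  refine ⟨fun e => Sym2.lift ⟨t, hs⟩ e.1, ?_⟩
  rintro ⟨e, he⟩ ⟨f, hf⟩ hne ⟨v, hv, hv'⟩
  obtain ⟨y, rfl⟩ := Sym2.mem_iff_exists.1 hv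
  obtain ⟨z, rfl⟩ := Sym2.mem_iff_exists.1 hv'
  refine ht v y z he hf ?_
  rintro rfl
  exact hne rfl

lemma deg_le_of_edgeColorable {n : ℕ} (h : EdgeColorable G n) (v : V) : deg G v ≤ n := by
  obtain ⟨c, hc⟩ := h
  have : Function.Injective (fun w : G.neighborSet v => c ⟨s(v, w), w.2⟩) := by
    intro w w' hw
    by_contra hne
    refine hc _ _ ?_ ⟨v, ?_, ?_⟩ hw
    · intro h
      apply hne
      exact Subtype.ext (Sym2.congr_right.1 (congrArg Subtype.val h))
    · simp
    · simp
  have h2 := Nat.card_le_card_of_injective _ this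
  simpa [deg] using h2

lemma chromaticIndex_le {n : ℕ} (h : EdgeColorable G n) : chromaticIndex G ≤ n :=
  iInf₂_le n h

lemma le_chromaticIndex {n : ℕ} (h : ∀ m, EdgeColorable G m → n ≤ m) :
    (n : ℕ∞) ≤ chromaticIndex G :=
  le_iInf₂ fun m hm => by exact_mod_cast h m hm

lemma deg_le_chromaticIndex (v : V) : (deg G v : ℕ∞) ≤ chromaticIndex G :=
  le_chromaticIndex fun _ hm => deg_le_of_edgeColorable hm v

end Coloring

/-! ### Greedy vertex colouring. -/

section Greedy
variable {W : Type*} [Finite W] {H : SimpleGraph W}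

/-- A partial colouring, proper on `S \ {x}`, extends to `S` if `x` has few neighbours in `S`. -/
lemma exists_extend {k : ℕ} {S : Set W} {x : W} (c : W → Fin k)
    (hc : ∀ y ∈ S \ {x}, ∀ z ∈ S \ {x}, H.Adj y z → c y ≠ c z)
    (hx : {y ∈ S | H.Adj x y}.ncard < k) :
    ∃ c : W → Fin k, ∀ y ∈ S, ∀ z ∈ S, H.Adj y z → c y ≠ c z := by
  classical
  obtain ⟨a, ha⟩ : ∃ a, a ∉ c '' {y ∈ S | H.Adj x y} := by
    by_contra! hall
    have h1 : c '' {y ∈ S | H.Adj x y} = Set.univ := Set.eq_univ_of_forall hall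
    have h2 := Set.ncard_image_le (f := c) (Set.toFinite {y ∈ S | H.Adj x y})
    rw [h1, Set.ncard_univ] at h2
    simp at h2
    omega
  refine ⟨Function.update c x a, fun y hy z hz hyz => ?_⟩
  by_cases hyx : y = x
  · subst hyx
    have hzy : z ≠ y := hyz.ne'
    rw [Function.update_self, Function.update_of_ne hzy]
    rintro rfl
    exact ha ⟨z, ⟨hz, hyz⟩, rfl⟩
  · by_cases hzx : z = x
    · subst hzx
      rw [Function.update_self, Function.update_of_ne hyx]
      rintro rfl
      exact ha ⟨y, ⟨hy, hyz.symm⟩, rfl⟩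
    · rw [Function.update_of_ne hyx, Function.update_of_ne hzx]
      exact hc y ⟨hy, hyx⟩ z ⟨hz, hzx⟩ hyz

/-- Greedy colouring along a degeneracy order. -/
lemma exists_coloring_of_degenerate {k : ℕ} (hk : 0 < k)
    (h : ∀ S : Set W, S.Nonempty → ∃ x ∈ S, {y ∈ S | H.Adj x y}.ncard < k) (S : Set W) :
    ∃ c : W → Fin k, ∀ y ∈ S, ∀ z ∈ S, H.Adj y z → c y ≠ c z := by
  induction hn : S.ncard generalizing S with
  | zero =>
    rw [Set.ncard_eq_zero (Set.toFinite _)] at hn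
    subst hn
    exact ⟨fun _ => ⟨0, hk⟩, by simp⟩
  | succ n ih =>
    obtain ⟨x, hx, hxk⟩ := h S (Set.nonempty_of_ncard_ne_zero (by omega))
    obtain ⟨c, hc⟩ := ih (S \ {x}) (by
      have := Set.ncard_sdiff_singleton_add_one hx (Set.toFinite _)
      omega)
    exact exists_extend c hc hxk

end Greedy

/-! ### Greedy edge colouring with heavy edges. -/

section Heavy
variable {V : Type*} [Finite V] {G : SimpleGraph V}

/-- Greedy edge colouring: the edges with `deg u + deg v ≤ k + 1` can be coloured last, and it is
enough that every other edge has an end at which it is the only such edge. -/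
lemma edgeColorable_of_heavy {k : ℕ} (hk : 0 < k)
    (h : ∀ u v, G.Adj u v → k + 2 ≤ deg G u + deg G v →
      ∃ a b, s(a, b) = s(u, v) ∧ deg G b ≤ k ∧
        ∀ w, G.Adj a w → w ≠ b → deg G a + deg G w ≤ k + 1) : EdgeColorable G k := by
  rw [edgeColorable_iff]
  suffices h' : ∀ S : Set G.edgeSet, S.Nonempty →
      ∃ x ∈ S, {y ∈ S | G.lineGraph.Adj x y}.ncard < k by
    obtain ⟨c, hc⟩ := exists_coloring_of_degenerate hk h' Set.univ
    exact ⟨c, fun e f => hc e trivial f trivial⟩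
  intro S hS
  by_cases hl : ∃ e ∈ S, deg G.lineGraph e < k
  · obtain ⟨e, he, hek⟩ := hl
    exact ⟨e, he, lt_of_le_of_lt (Set.ncard_le_ncard (fun f hf => hf.2) (Set.toFinite _)) hek⟩
  -- Now every edge of `S` has degree sum at least `k + 2`. The hypothesis at `a` therefore excludes
  -- further edges of `S` there, so all neighbours in `S` of the chosen edge lie at `b`, at most
  -- `deg G b - 1 < k` of them.
  push Not at hl
  have hS' : ∀ u v (huv : G.Adj u v), (⟨s(u, v), huv⟩ : G.edgeSet) ∈ S →
      k + 2 ≤ deg G u + deg G v := by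
    intro u v huv hm
    have h1 := hl _ hm
    have h2 := deg_lineGraph huv
    omega
  obtain ⟨⟨e, he⟩, heS⟩ := hS
  induction e with | _ u v
  obtain ⟨a, b, hab, hb, ha⟩ := h u v he (hS' u v he heS)
  have hab' : G.Adj a b := by
    have : s(a, b) ∈ G.edgeSet := hab ▸ he
    exact this
  refine ⟨_, heS, ?_⟩
  have h1 : Subtype.val '' {y ∈ S | G.lineGraph.Adj ⟨s(u, v), he⟩ y} ⊆
      G.incidenceSet b \ {s(a, b)} := by
    rintro _ ⟨f, ⟨hfS, hf⟩, rfl⟩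
    have h2 : f.1 ∈ (G.incidenceSet a ∪ G.incidenceSet b) \ {s(a, b)} := by
      rw [← image_neighborSet_lineGraph hab']
      refine ⟨f, ?_, rfl⟩
      simpa [hab] using hf
    obtain ⟨h3 | h3, h4⟩ := h2
    · exfalso
      obtain ⟨f, hfE⟩ := f
      obtain ⟨w, rfl⟩ := Sym2.mem_iff_exists.1 h3.2
      have h5 := hS' a w hfE hfS
      have h6 := ha w hfE (by rintro rfl; exact h4 rfl)
      omega
    · exact ⟨h3, h4⟩
  have h2 := Set.ncard_le_ncard h1 (Set.toFinite _)
  rw [Set.ncard_image_of_injective _ Subtype.val_injective] at h2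
  have h3 := Set.ncard_sdiff_singleton_add_one (s := G.incidenceSet b) (a := s(a, b))
    ⟨hab', by simp⟩ (Set.toFinite _)
  rw [ncard_incidenceSet] at h3
  exact lt_of_le_of_lt h2 (by omega)

lemma edgeColorable_of_forall_le {k : ℕ} (hk : 0 < k)
    (h : ∀ u v, G.Adj u v → deg G u + deg G v ≤ k + 1) : EdgeColorable G k :=
  edgeColorable_of_heavy hk fun u v huv h' => by
    have := h u v huv
    omega

end Heavy

/-! ### Kempe changes. -/

section Kempe
variable {W : Type*} [Finite W]

/-- A connected graph of maximum degree at most two has at most two vertices of degree one. -/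
lemma not_all_reachable_of_deg_le_two (K : SimpleGraph W) {x y z : W}
    (hxy : x ≠ y) (hxz : x ≠ z) (hyz : y ≠ z) (h2 : ∀ w, deg K w ≤ 2)
    (hx : deg K x ≤ 1) (hy : deg K y ≤ 1) (hz : deg K z ≤ 1) :
    ¬ (K.Reachable x y ∧ K.Reachable x z) := by
  classical
  rintro ⟨hry, hrz⟩
  have := Fintype.ofFinite W
  set C := K.connectedComponentMk x with hC
  have hconn := C.connected_toSimpleGraph
  have := Fintype.ofFinite C
  have h1 := hconn.card_vert_le_card_edgeSet_add_one
  have h3 := C.toSimpleGraph.sum_degrees_eq_twice_card_edges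
  rw [Nat.card_eq_fintype_card, Nat.card_eq_fintype_card, ← edgeFinset_card] at h1
  have hd : ∀ w : C, C.toSimpleGraph.degree w ≤ deg K w := by
    intro w
    rw [← card_neighborSet_eq_degree, ← Nat.card_eq_fintype_card, deg]
    refine Nat.card_le_card_of_injective
      (fun v : C.toSimpleGraph.neighborSet w => (⟨v.1.1, v.2⟩ : K.neighborSet w)) ?_
    intro a b hab
    exact Subtype.ext (Subtype.ext (Subtype.mk.inj hab))
  let X : C := ⟨x, rfl⟩
  let Y : C := ⟨y, ConnectedComponent.sound hry.symm⟩
  let Z : C := ⟨z, ConnectedComponent.sound hrz.symm⟩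
  have hXY : X ≠ Y := fun h => hxy (congrArg Subtype.val h)
  have hXZ : X ≠ Z := fun h => hxz (congrArg Subtype.val h)
  have hYZ : Y ≠ Z := fun h => hyz (congrArg Subtype.val h)
  -- Connectedness gives |C| ≤ |E| + 1, whereas three vertices of degree at most one would give 2|E|
  -- ≤ 2|C| - 3.
  have h4 : ∑ w, (C.toSimpleGraph.degree w + if w ∈ ({X, Y, Z} : Finset C) then 1 else 0) ≤
      ∑ _w : C, 2 := by
    refine Finset.sum_le_sum fun w _ => ?_
    split_ifs with hw
    · simp only [Finset.mem_insert, Finset.mem_singleton] at hw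
      have := hd w
      rcases hw with rfl | rfl | rfl
      · change _ ≤ deg K x at this; omega
      · change _ ≤ deg K y at this; omega
      · change _ ≤ deg K z at this; omega
    · have := hd w
      have := h2 w
      omega
  rw [Finset.sum_add_distrib, Finset.sum_ite_mem, Finset.univ_inter, Finset.sum_const,
    Finset.sum_const, Finset.card_univ, Finset.card_eq_three.2 ⟨X, Y, Z, hXY, hXZ, hYZ, rfl⟩] at h4
  simp only [smul_eq_mul] at h4
  omega

/-- Kempe change: if three vertices of `T` have the same colour in a proper partial colouring whose
two-coloured subgraphs have maximum degree two, and degree one at these three vertices, then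
some proper colouring of `T` does not give all three the same colour. -/
lemma exists_kempe_change {H : SimpleGraph W} {T : Set W} (c : W → Fin 3)
    (hc : ∀ x ∈ T, ∀ y ∈ T, H.Adj x y → c x ≠ c y) {x y z : W} 
    (hxy : x ≠ y) (hxz : x ≠ z) (hyz : y ≠ z)
    (h2 : ∀ w ∈ T, ∀ a, {v ∈ T | H.Adj w v ∧ c v = a}.ncard ≤ 2)
    (hx : ∀ a, {v ∈ T | H.Adj x v ∧ c v = a}.ncard ≤ 1)
    (hy : ∀ a, {v ∈ T | H.Adj y v ∧ c v = a}.ncard ≤ 1)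
    (hz : ∀ a, {v ∈ T | H.Adj z v ∧ c v = a}.ncard ≤ 1) :
    ∃ c' : W → Fin 3, (∀ x ∈ T, ∀ y ∈ T, H.Adj x y → c' x ≠ c' y) ∧
      ¬ (c' x = c' y ∧ c' x = c' z) := by
  classical
  by_cases hall : c x = c y ∧ c x = c z
  swap
  · exact ⟨c, hc, hall⟩
  obtain ⟨hcy, hcz⟩ := hall
  obtain ⟨b, hb⟩ : ∃ b, b ≠ c x := exists_ne _
  -- `K` is the subgraph of `T` on the colours `c x` and `b`. Its component of `x` misses `y` or
  -- `z`, so swapping the two colours there separates the colour of `x` from that of the missed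
  -- vertex.
  let K : SimpleGraph W :=
    { Adj := fun v w => H.Adj v w ∧ v ∈ T ∧ w ∈ T ∧ (c v = c x ∨ c v = b) ∧ (c w = c x ∨ c w = b)
      symm := ⟨fun v w h => ⟨h.1.symm, h.2.2.1, h.2.1, h.2.2.2.2, h.2.2.2.1⟩⟩
      loopless := ⟨fun v h => h.1.ne rfl⟩ }
  have hK : ∀ v, deg K v = 0 ∨
      v ∈ T ∧ ∃ a, K.neighborSet v ⊆ {w ∈ T | H.Adj v w ∧ c w = a} := by
    intro v
    by_cases hv : v ∈ T ∧ (c v = c x ∨ c v = b)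
    · refine Or.inr ⟨hv.1, ?_⟩
      rcases hv.2 with h | h
      · refine ⟨b, fun w hw => ⟨hw.2.2.1, hw.1, ?_⟩⟩
        exact hw.2.2.2.2.resolve_left fun h' => hc v hv.1 w hw.2.2.1 hw.1 (h.trans h'.symm)
      · refine ⟨c x, fun w hw => ⟨hw.2.2.1, hw.1, ?_⟩⟩
        exact hw.2.2.2.2.resolve_right fun h' => hc v hv.1 w hw.2.2.1 hw.1 (h.trans h'.symm)
    · left
      rw [deg, Set.ncard_eq_zero (Set.toFinite _)]
      ext w
      simp only [mem_neighborSet, Set.mem_empty_iff_false, iff_false]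
      exact fun hw => hv ⟨hw.2.1, hw.2.2.2.1⟩
  have hone : ∀ v, (∀ a, {w ∈ T | H.Adj v w ∧ c w = a}.ncard ≤ 1) → deg K v ≤ 1 := by
    intro v hv
    rcases hK v with h | ⟨-, a, h⟩
    · omega
    · exact (Set.ncard_le_ncard h (Set.toFinite _)).trans (hv a)
  have hnr := not_all_reachable_of_deg_le_two K hxy hxz hyz (fun v => by
    rcases hK v with h | ⟨hv, a, h⟩
    · omega
    · exact (Set.ncard_le_ncard h (Set.toFinite _)).trans (h2 v hv a)) (hone x hx) (hone y hy)
    (hone z hz)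
  have hcol : ∀ v, K.Reachable x v → c v = c x ∨ c v = b := by
    intro v hv
    obtain ⟨p⟩ := hv.symm
    cases p with
    | nil => exact Or.inl rfl
    | cons h _ => exact h.2.2.2.1
  refine ⟨fun v => if K.Reachable x v then Equiv.swap (c x) b (c v) else c v, ?_, ?_⟩
  · have key : ∀ v ∈ T, ∀ w ∈ T, H.Adj v w → K.Reachable x v → ¬ K.Reachable x w →
        Equiv.swap (c x) b (c v) ≠ c w := by
      intro v hv w hw hvw hrv hrw
      have h1 : ¬ (c w = c x ∨ c w = b) := fun h =>
        hrw (hrv.trans (Adj.reachable ⟨hvw, hv, hw, hcol v hrv, h⟩))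
      rcases hcol v hrv with h | h
      · rw [h, Equiv.swap_apply_left]
        exact fun h' => h1 (Or.inr h'.symm)
      · rw [h, Equiv.swap_apply_right]
        exact fun h' => h1 (Or.inl h'.symm)
    intro v hv w hw hvw
    dsimp only
    split_ifs with hrv hrw hrw
    · exact fun h => hc v hv w hw hvw ((Equiv.swap _ _).injective h)
    · exact key v hv w hw hvw hrv hrw
    · exact (key w hw v hv hvw.symm hrw hrv).symm
    · exact hc v hv w hw hvw
  · dsimp only
    rw [if_pos (Reachable.refl x), Equiv.swap_apply_left]
    rintro ⟨h1, h2⟩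
    refine hnr ⟨?_, ?_⟩
    · by_contra h
      rw [if_neg h] at h1
      exact hb (h1.trans hcy.symm)
    · by_contra h
      rw [if_neg h] at h2
      exact hb (h2.trans hcz.symm)

end Kempe

/-! ### Three-edge-colouring when no two cubic vertices are adjacent. -/

section Cubic
variable {V : Type*} {G : SimpleGraph V}

lemma exists_eq_triple {v : V} (h : deg G v = 3) :
    ∃ a b c, a ≠ b ∧ a ≠ c ∧ b ≠ c ∧ G.neighborSet v = {a, b, c} :=
  Set.ncard_eq_three.1 h

lemma exists_eq_pair {v u : V} (h : deg G v = 2) (huv : G.Adj v u) :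
    ∃ w, w ≠ u ∧ G.Adj v w ∧ ∀ x, G.Adj v x → x = u ∨ x = w := by
  obtain ⟨a, b, hab, hs⟩ := Set.ncard_eq_two.1 h
  have hmem : ∀ x, G.Adj v x ↔ x = a ∨ x = b := fun x => by
    rw [← mem_neighborSet, hs]; simp
  rcases (hmem u).1 huv with rfl | rfl
  · exact ⟨b, hab.symm, (hmem b).2 (Or.inr rfl), fun x hx => (hmem x).1 hx⟩
  · exact ⟨a, hab, (hmem a).2 (Or.inl rfl), fun x hx => ((hmem x).1 hx).symm⟩

/-- Edges of `T` of a given colour at a given vertex: there is at most one. -/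
lemma ncard_colored_incident_le_one [Finite V] {T : Set G.edgeSet} {c : G.edgeSet → Fin 3}
    (hc : ∀ x ∈ T, ∀ y ∈ T, G.lineGraph.Adj x y → c x ≠ c y) (a : Fin 3) (v : V) :
    {e ∈ T | v ∈ e.1 ∧ c e = a}.ncard ≤ 1 := by
  rw [Set.ncard_le_one (Set.toFinite _)]
  rintro e ⟨he, hve, hea⟩ f ⟨hf, hvf, hfa⟩
  by_contra hne
  exact hc e he f hf (lineGraph_adj_iff_exists.2 ⟨hne, v, hve, hvf⟩) (hea.trans hfa.symm)

/-- Hall's condition for three lists of two colours, each list omitting one colour: it fails only if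
all three lists coincide. -/
lemma exists_fin_three_sdr (a b c : Fin 3) (h : ¬ (a = b ∧ a = c)) :
    ∃ x y z : Fin 3, x ≠ y ∧ x ≠ z ∧ y ≠ z ∧ x ≠ a ∧ y ≠ b ∧ z ≠ c := by
  revert a b c
  decide

lemma ite_ite_ne {α β : Type*} [DecidableEq α] {a b c x y : α} {p q r : β} (hab : a ≠ b)
    (hac : a ≠ c) (hbc : b ≠ c) (hpq : p ≠ q) (hpr : p ≠ r) (hqr : q ≠ r)
    (hx : x = a ∨ x = b ∨ x = c) (hy : y = a ∨ y = b ∨ y = c) (hxy : x ≠ y) :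
    (if x = a then p else if x = b then q else r) ≠
      (if y = a then p else if y = b then q else r) := by
  rcases hx with rfl | rfl | rfl <;> rcases hy with rfl | rfl | rfl <;>
    simp_all [Ne.symm, eq_comm]

/-- A graph of maximum degree three in which no two vertices of degree three are adjacent is
3-edge-colourable. -/
lemma edgeColorable_three [Finite V] (h3 : ∀ v, deg G v ≤ 3)
    (h5 : ∀ u v, G.Adj u v → deg G u + deg G v ≤ 5) : EdgeColorable G 3 := by
  classical
  rw [edgeColorable_iff]
  suffices ∀ n, ∀ S : Set G.edgeSet, S.ncard = n → ∃ c : G.edgeSet → Fin 3,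
      ∀ y ∈ S, ∀ z ∈ S, G.lineGraph.Adj y z → c y ≠ c z by
    obtain ⟨c, hc⟩ := this _ Set.univ rfl
    exact ⟨c, fun e f => hc e trivial f trivial⟩
  intro n
  induction n using Nat.strong_induction_on with
  | _ n ih =>
  intro S hS
  by_cases hl : ∃ e ∈ S, {y ∈ S | G.lineGraph.Adj e y}.ncard < 3
  · obtain ⟨e, he, hek⟩ := hl
    have := Set.ncard_sdiff_singleton_add_one he (Set.toFinite _)
    obtain ⟨c, hc⟩ := ih _ (by omega) (S \ {e}) rfl
    exact exists_extend c hc hek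
  push Not at hl
  rcases S.eq_empty_or_nonempty with rfl | ⟨e0, he0⟩
  · exact ⟨fun _ => 0, by simp⟩
  -- No edge of `S` can be coloured last, so each has at least three neighbours in `S`. Degree sum
  -- at most 5 allows at most three neighbours in all, so `S` is closed under adjacency and all its
  -- edges have degree sum exactly 5, joining vertices of degrees 3 and 2.
  have hcl : ∀ e ∈ S, ∀ f, G.lineGraph.Adj e f → f ∈ S := by
    intro e he f hf
    have h1 := hl e he
    have h2 : deg G.lineGraph e ≤ 3 := by
      obtain ⟨e, heE⟩ := e
      induction e with | _ u v
      have huv : G.Adj u v := heE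
      have := deg_lineGraph huv
      have := h5 u v huv
      change deg G.lineGraph ⟨s(u, v), huv⟩ ≤ 3
      omega
    have h3 : {y ∈ S | G.lineGraph.Adj e y} = G.lineGraph.neighborSet e :=
      Set.eq_of_subset_of_ncard_le (fun y hy => hy.2) (h2.trans h1) (Set.toFinite _)
    have : f ∈ {y ∈ S | G.lineGraph.Adj e y} := h3 ▸ hf
    exact this.1
  have hsum : ∀ u v (h : G.Adj u v), (⟨s(u, v), h⟩ : G.edgeSet) ∈ S → deg G u + deg G v = 5 := by
    intro u v h hm
    have h1 := hl _ hm
    have h2 := deg_lineGraph h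
    have h6 := h5 u v h
    have h4 : {y ∈ S | G.lineGraph.Adj ⟨s(u, v), h⟩ y}.ncard ≤ deg G.lineGraph ⟨s(u, v), h⟩ :=
      Set.ncard_le_ncard (fun y hy => hy.2) (Set.toFinite _)
    omega
  obtain ⟨u, hu3, hus⟩ : ∃ u, deg G u = 3 ∧ ∃ v, ∃ h : G.Adj u v, (⟨s(u, v), h⟩ : G.edgeSet) ∈ S := by
    obtain ⟨e, heE⟩ := e0
    induction e with | _ u v
    have h1 := hsum u v heE he0
    have h2 := h3 u
    have h4 := h3 v
    have huv : G.Adj u v := heE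
    by_cases h : deg G u = 3
    · exact ⟨u, h, v, heE, he0⟩
    · refine ⟨v, by omega, u, huv.symm, ?_⟩
      have h6 : (⟨s(v, u), huv.symm⟩ : G.edgeSet) = ⟨s(u, v), heE⟩ := Subtype.ext Sym2.eq_swap
      rwa [h6]
  obtain ⟨v0, hv0, hv0S⟩ := hus
  have huS : ∀ v (h : G.Adj u v), (⟨s(u, v), h⟩ : G.edgeSet) ∈ S := by
    intro v h
    by_cases hv : v = v0
    · subst hv; exact hv0S
    · exact hcl _ hv0S _ (lineGraph_adj_of_adj hv0 h (Ne.symm hv))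
  obtain ⟨v1, v2, v3, h12, h13, h23, hN⟩ := exists_eq_triple hu3
  have hNm : ∀ x, G.Adj u x ↔ x = v1 ∨ x = v2 ∨ x = v3 := fun x => by
    rw [← mem_neighborSet, hN]; simp
  have hv1 : G.Adj u v1 := (hNm _).2 (by simp)
  have hv2 : G.Adj u v2 := (hNm _).2 (by simp)
  have hv3 : G.Adj u v3 := (hNm _).2 (by simp)
  -- the second edge at each neighbour of `u`
  have hsecond : ∀ v (h : G.Adj u v), ∃ f ∈ S, u ∉ f.1 ∧ v ∈ f.1 ∧
      (∀ g : G.edgeSet, v ∈ g.1 → g = ⟨s(u, v), h⟩ ∨ g = f) ∧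
      ∀ v', G.Adj u v' → v' ∈ f.1 → v' = v := by
    intro v h
    have hv2 : deg G v = 2 := by have := hsum u v h (huS v h); omega
    obtain ⟨w, hwu, hvw, hw⟩ := exists_eq_pair hv2 h.symm
    have hf : (⟨s(v, w), hvw⟩ : G.edgeSet) ∈ S := by
      have h1 := lineGraph_adj_of_adj h.symm hvw hwu.symm
      have h6 : (⟨s(v, u), h.symm⟩ : G.edgeSet) = ⟨s(u, v), h⟩ := Subtype.ext Sym2.eq_swap
      rw [h6] at h1
      exact hcl _ (huS v h) _ h1
    refine ⟨⟨s(v, w), hvw⟩, hf, ?_, by simp, ?_, ?_⟩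
    · simp only [Sym2.mem_iff, not_or]
      exact ⟨h.ne, hwu.symm⟩
    · rintro ⟨g, hg⟩ hvg
      obtain ⟨x, rfl⟩ := Sym2.mem_iff_exists.1 hvg
      rcases hw x hg with rfl | rfl
      · exact Or.inl (Subtype.ext Sym2.eq_swap)
      · exact Or.inr rfl
    · intro v' hv' hm
      rcases Sym2.mem_iff.1 hm with rfl | rfl
      · rfl
      · exfalso
        have h1 := hsum v v' hvw hf
        have h2 := hsum u v' hv' (huS _ hv')
        omega
  obtain ⟨f1, hf1S, huf1, hvf1, hf1, hf1'⟩ := hsecond v1 hv1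
  obtain ⟨f2, hf2S, huf2, hvf2, hf2, hf2'⟩ := hsecond v2 hv2
  obtain ⟨f3, hf3S, huf3, hvf3, hf3, hf3'⟩ := hsecond v3 hv3
  have hf12 : f1 ≠ f2 := by rintro rfl; exact h12 (hf2' v1 hv1 hvf1)
  have hf13 : f1 ≠ f3 := by rintro rfl; exact h13 (hf3' v1 hv1 hvf1)
  have hf23 : f2 ≠ f3 := by rintro rfl; exact h23 (hf3' v2 hv2 hvf2)
  -- Delete the three edges at the cubic vertex `u` and colour the rest by induction. Each `f i` has
  -- lost its only neighbour at `v i`, so it has at most one neighbour of each colour, as the Kempe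
  -- change requires. Once `f1`, `f2`, `f3` are not all of one colour, the edges at `u` can be
  -- coloured.
  set T : Set G.edgeSet := {e ∈ S | u ∉ e.1} with hT
  have hTS : T.ncard < S.ncard := by
    refine Set.ncard_lt_ncard ⟨fun e he => he.1, fun h => ?_⟩ (Set.toFinite _)
    exact (h (huS v1 hv1)).2 (by simp)
  obtain ⟨c0, hc0⟩ := ih _ (hS ▸ hTS) T rfl
  -- the edges of `T` of a given colour adjacent to a given edge
  have hfew : ∀ v (h : G.Adj u v) f, v ∈ f.1 → (∀ g : G.edgeSet, v ∈ g.1 → g = ⟨s(u, v), h⟩ ∨ g = f) →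
      ∀ a, {g ∈ T | G.lineGraph.Adj f g ∧ c0 g = a}.ncard ≤ 1 := by
    intro v h f hvf hf a
    obtain ⟨w, hw⟩ := Sym2.mem_iff_exists.1 hvf
    refine (Set.ncard_le_ncard ?_ (Set.toFinite _)).trans (ncard_colored_incident_le_one hc0 a w)
    rintro g ⟨hgT, hfg, hga⟩
    refine ⟨hgT, ?_, hga⟩
    obtain ⟨hne, x, hxf, hxg⟩ := lineGraph_adj_iff_exists.1 hfg
    rw [hw] at hxf
    rcases Sym2.mem_iff.1 hxf with rfl | rfl
    · exfalso
      rcases hf g hxg with rfl | rfl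
      · exact hgT.2 (by simp)
      · exact hne rfl
    · exact hxg
  obtain ⟨c, hc, hne⟩ := exists_kempe_change (x := f1) (y := f2) (z := f3) c0 hc0
    hf12 hf13 hf23 (by
      rintro ⟨e, he⟩ - a
      induction e with | _ p q
      have h1 := ncard_colored_incident_le_one hc0 a p
      have h2 := ncard_colored_incident_le_one hc0 a q
      have h3 := Set.ncard_union_le {e ∈ T | p ∈ e.1 ∧ c0 e = a} {e ∈ T | q ∈ e.1 ∧ c0 e = a}
      refine (Set.ncard_le_ncard ?_ (Set.toFinite _)).trans (h3.trans (by omega))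
      rintro g ⟨hgT, hfg, hga⟩
      obtain ⟨-, x, hxf, hxg⟩ := lineGraph_adj_iff_exists.1 hfg
      rcases Sym2.mem_iff.1 hxf with rfl | rfl
      · exact Or.inl ⟨hgT, hxg, hga⟩
      · exact Or.inr ⟨hgT, hxg, hga⟩)
    (hfew v1 hv1 f1 hvf1 hf1) (hfew v2 hv2 f2 hvf2 hf2) (hfew v3 hv3 f3 hvf3 hf3)
  obtain ⟨a1, a2, a3, ha12, ha13, ha23, ha1, ha2, ha3⟩ := exists_fin_three_sdr _ _ _ hne
  -- the colour given to an edge at `u`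
  let d : G.edgeSet → Fin 3 := fun e => if v1 ∈ e.1 then a1 else if v2 ∈ e.1 then a2 else a3
  have hd : ∀ v (h : G.Adj u v), d ⟨s(u, v), h⟩ = if v = v1 then a1 else if v = v2 then a2 else a3 := by
    intro v h
    simp only [d, Sym2.mem_iff, hv1.ne', hv2.ne', false_or, eq_comm]
  have hdT : ∀ v (h : G.Adj u v), ∀ g ∈ T, G.lineGraph.Adj ⟨s(u, v), h⟩ g →
      d ⟨s(u, v), h⟩ ≠ c g := by
    intro v h g hg hadj
    obtain ⟨-, x, hx, hxg⟩ := lineGraph_adj_iff_exists.1 hadj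
    have hxv : x = v := by
      rcases Sym2.mem_iff.1 hx with rfl | rfl
      · exact absurd hxg hg.2
      · rfl
    subst hxv
    have hnot : g ≠ ⟨s(u, x), h⟩ := by rintro rfl; exact hg.2 (by simp)
    rw [hd]
    rcases (hNm x).1 h with rfl | rfl | rfl
    · rw [if_pos rfl, (hf1 g hxg).resolve_left hnot]
      exact ha1
    · rw [if_neg h12.symm, if_pos rfl, (hf2 g hxg).resolve_left hnot]
      exact ha2
    · rw [if_neg h13.symm, if_neg h23.symm, (hf3 g hxg).resolve_left hnot]
      exact ha3
  refine ⟨fun e => if u ∈ e.1 then d e else c e, ?_⟩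
  rintro ⟨e, heE⟩ heS ⟨f, hfE⟩ hfS hef
  dsimp only
  split_ifs with hue huf huf
  · obtain ⟨x, rfl⟩ := Sym2.mem_iff_exists.1 hue
    obtain ⟨y, rfl⟩ := Sym2.mem_iff_exists.1 huf
    have hx : G.Adj u x := heE
    have hy : G.Adj u y := hfE
    have hxy : x ≠ y := by rintro rfl; exact hef.ne rfl
    rw [hd x hx, hd y hy]
    exact ite_ite_ne h12 h13 h23 ha12 ha13 ha23 ((hNm x).1 hx) ((hNm y).1 hy) hxy
  · obtain ⟨x, rfl⟩ := Sym2.mem_iff_exists.1 hue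
    exact hdT x heE _ ⟨hfS, huf⟩ hef
  · obtain ⟨x, rfl⟩ := Sym2.mem_iff_exists.1 huf
    exact (hdT x hfE _ ⟨heS, hue⟩ hef.symm).symm
  · exact hc _ ⟨heS, hue⟩ _ ⟨hfS, huf⟩ hef

end Cubic

/-! ### Bounds on the index from degrees and colourings. -/

section Index
variable {V : Type u} {G : SimpleGraph V}

/-- χ'(G) ≤ k < deg ≤ χ'(Lʳ(G)). -/
lemma ind_le {r k : ℕ} (hk : EdgeColorable G k) (v : (iterLineGraph G r).1)
    (hv : k < deg (iterLineGraph G r).2 v) :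
    ind (fun _ H => chromaticIndex H) G ≤ r := by
  refine iInf₂_le r ?_
  refine (chromaticIndex_le hk).trans_lt (lt_of_lt_of_le ?_ (deg_le_chromaticIndex v))
  exact_mod_cast hv

lemma three_le_ind {k : ℕ} (hk : (k : ℕ∞) ≤ chromaticIndex G) (h1 : EdgeColorable G.lineGraph k)
    (h2 : EdgeColorable G.lineGraph.lineGraph k) :
    3 ≤ ind (fun _ H => chromaticIndex H) G := by
  refine le_iInf₂ fun r hr => ?_
  match r, hr with
  | 0, hr => exact absurd hr (lt_irrefl _)
  | 1, hr => exact absurd hr (not_lt.2 ((chromaticIndex_le h1).trans hk))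
  | 2, hr => exact absurd hr (not_lt.2 ((chromaticIndex_le h2).trans hk))
  | r + 3, _ =>
    push_cast
    exact le_add_self

variable [Finite V]

lemma ind_le_one {k : ℕ} (hk : EdgeColorable G k) {u v : V} (h : G.Adj u v)
    (hd : k + 2 < deg G u + deg G v) : ind (fun _ H => chromaticIndex H) G ≤ 1 := by
  have := deg_lineGraph h
  exact ind_le (r := 1) hk (⟨s(u, v), h⟩ : G.edgeSet) (by change k < deg G.lineGraph _; omega)

/-- The vertex of `L²(G)` given by a path of length two in `G`. -/
def cherry {u x y : V} (hx : G.Adj u x) (hy : G.Adj u y) (hxy : x ≠ y) :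
    G.lineGraph.edgeSet :=
  ⟨s(⟨s(u, x), hx⟩, ⟨s(u, y), hy⟩), lineGraph_adj_of_adj hx hy hxy⟩

/-- The degree formula for line graphs, applied to `ux` and `uy` and then to the edge of L(G)
joining them. -/
lemma deg_cherry {u x y : V} (hx : G.Adj u x) (hy : G.Adj u y) (hxy : x ≠ y) :
    deg G.lineGraph.lineGraph (cherry hx hy hxy) + 6 = deg G x + 2 * deg G u + deg G y := by
  have h1 := deg_lineGraph hx
  have h2 := deg_lineGraph hy
  have h3 := deg_lineGraph (lineGraph_adj_of_adj hx hy hxy)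
  have h4 : deg G.lineGraph.lineGraph (cherry hx hy hxy) =
    deg G.lineGraph.lineGraph ⟨_, lineGraph_adj_of_adj hx hy hxy⟩ := rfl
  omega

lemma ind_le_two {k : ℕ} (hk : EdgeColorable G k) {u x y : V} (hx : G.Adj u x) (hy : G.Adj u y)
    (hxy : x ≠ y) (hd : k + 6 < deg G x + 2 * deg G u + deg G y) :
    ind (fun _ H => chromaticIndex H) G ≤ 2 := by
  have h1 := deg_cherry hx hy hxy
  have h2 : k < deg G.lineGraph.lineGraph (cherry hx hy hxy) := by omega
  exact ind_le (r := 2) hk (cherry hx hy hxy) h2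

/-- Two cherries sharing the edge `ux` are adjacent in L²(G); the edge between them is a vertex of
L³(G) whose degree exceeds `k` by `hd`. -/
lemma ind_le_three {k : ℕ} (hk : EdgeColorable G k) {u x y z : V} (hx : G.Adj u x)
    (hy : G.Adj u y) (hz : G.Adj u z) (hxy : x ≠ y) (hxz : x ≠ z) (hyz : y ≠ z)
    (hd : k + 14 < 2 * deg G x + 4 * deg G u + deg G y + deg G z) :
    ind (fun _ H => chromaticIndex H) G ≤ 3 := by
  have h1 := deg_cherry hx hy hxy
  have h2 := deg_cherry hx hz hxz
  have hadj : G.lineGraph.lineGraph.Adj (cherry hx hy hxy) (cherry hx hz hxz) := by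
    refine lineGraph_adj_of_adj _ _ fun h => ?_
    exact hyz (Sym2.congr_right.1 (congrArg Subtype.val h))
  have h3 := deg_lineGraph hadj
  have h4 : k < deg G.lineGraph.lineGraph.lineGraph
      ⟨s(cherry hx hy hxy, cherry hx hz hxz), hadj⟩ := by omega
  exact ind_le (r := 3) hk (⟨s(cherry hx hy hxy, cherry hx hz hxz), hadj⟩ :
    G.lineGraph.lineGraph.edgeSet) h4

end Index

/-! ### Recognising a graph from its neighbourhoods. -/

section Structure
variable {V : Type u} {G : SimpleGraph V}

lemma mem_of_closed (hconn : G.Connected) {S : Set V} {v : V} (hv : v ∈ S)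
    (hS : ∀ x ∈ S, ∀ y, G.Adj x y → y ∈ S) (w : V) : w ∈ S := by
  obtain ⟨p⟩ := hconn.preconnected v w
  induction p with
  | nil => exact hv
  | cons h _ ih => exact ih (hS _ hv _ h)

/-- An injective, adjacency preserving and locally surjective map onto a connected graph
is an isomorphism. -/
lemma nonempty_iso {W : Type*} {H : SimpleGraph W} [Nonempty W] (hconn : G.Connected) (f : W → V)
    (hf : Function.Injective f) (hadj : ∀ x y, H.Adj x y → G.Adj (f x) (f y))
    (hloc : ∀ x v, G.Adj (f x) v → ∃ y, H.Adj x y ∧ f y = v) : Nonempty (G ≃g H) := by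
  have hsurj : Function.Surjective f := by
    intro v
    refine mem_of_closed hconn (S := Set.range f) (v := f (Classical.arbitrary W))
      ⟨_, rfl⟩ ?_ v
    rintro _ ⟨x, rfl⟩ y hy
    obtain ⟨z, -, hz⟩ := hloc x y hy
    exact ⟨z, hz⟩
  refine ⟨RelIso.symm ⟨Equiv.ofBijective f ⟨hf, hsurj⟩, ?_⟩⟩
  intro a b
  refine ⟨fun h => ?_, hadj a b⟩
  obtain ⟨y, hy, hyb⟩ := hloc a (f b) h
  rwa [← hf hyb]

variable [Finite V]

/-- The device by which neighbourhoods are read off from degrees: a list of distinct neighbours that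
reaches the degree leaves no room for others. -/
lemma mem_of_deg_le {v : V} {l : List V} (hl : l.Nodup) (hadj : ∀ x ∈ l, G.Adj v x)
    (hd : deg G v ≤ l.length) {x : V} (hx : G.Adj v x) : x ∈ l := by
  classical
  have h1 : ((l.toFinset : Finset V) : Set V) = G.neighborSet v := by
    refine Set.eq_of_subset_of_ncard_le (fun y hy => hadj y (by simpa using hy)) ?_ (Set.toFinite _)
    rw [Set.ncard_coe_finset, List.toFinset_card_of_nodup hl]
    exact hd
  have : x ∈ ((l.toFinset : Finset V) : Set V) := h1 ▸ hx
  simpa using this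

lemma length_le_deg {v : V} {l : List V} (hl : l.Nodup) (hadj : ∀ x ∈ l, G.Adj v x) :
    l.length ≤ deg G v := by
  classical
  rw [← List.toFinset_card_of_nodup hl, ← Set.ncard_coe_finset]
  exact Set.ncard_le_ncard (fun y hy => hadj y (by simpa using hy)) (Set.toFinite _)

/-- A vertex whose list of neighbours is shorter than its degree has another neighbour. -/
lemma exists_adj_notMem {v : V} {l : List V} (h : l.length < deg G v) :
    ∃ x, G.Adj v x ∧ x ∉ l := by
  classical
  obtain ⟨x, hx, hx'⟩ := Set.exists_mem_notMem_of_ncard_lt_ncard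
    (s := ((l.toFinset : Finset V) : Set V)) (t := G.neighborSet v) (by
      rw [Set.ncard_coe_finset]
      exact lt_of_le_of_lt l.toFinset_card_le h)
  exact ⟨x, hx, by simpa using hx'⟩

/-- A vertex of degree `n` all of whose neighbours are leaves is the centre of a star. -/
lemma nonempty_iso_star (hconn : G.Connected) {n : ℕ} {u : V} (hu : deg G u = n)
    (hleaf : ∀ v, G.Adj u v → deg G v ≤ 1) :
    Nonempty (G ≃g completeBipartiteGraph (Fin 1) (Fin n)) := by
  classical
  have e : Fin n ≃ G.neighborSet u := by
    refine (Finite.equivFinOfCardEq ?_).symm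
    exact hu
  refine nonempty_iso hconn (Sum.elim (fun _ => u) (fun i => (e i).1)) ?_ ?_ ?_
  · rintro (i | i) (j | j) h
    · simp [Subsingleton.elim i j]
    · exact absurd h (e j).2.ne
    · exact absurd h.symm (e i).2.ne
    · simpa using e.injective (Subtype.ext h)
  · rintro (i | i) (j | j) h
    · simp at h
    · exact (e j).2
    · exact (e i).2.symm
    · simp at h
  · rintro (i | i) v hv
    · exact ⟨Sum.inr (e.symm ⟨v, hv⟩), by simp, by simp⟩
    · have h1 := hleaf _ (e i).2
      have h2 : v ∈ [u] := mem_of_deg_le (v := (e i).1) (by simp)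
        (by simpa using (e i).2.symm) (by simpa using h1) hv
      refine ⟨Sum.inl 0, by simp, ?_⟩
      simpa [eq_comm] using h2

end Structure

/-! ### Reduction to stars and sparse graphs. -/

section Main
variable {V : Type u} [Finite V] {G : SimpleGraph V}

/-- The graphs that escape the degree bounds for the second iterated line graph. -/
structure IsSparse (G : SimpleGraph V) : Prop where
  deg_le : ∀ v, deg G v ≤ 3
  exists_deg : ∃ v, deg G v = 3
  adj_le : ∀ u v, G.Adj u v → deg G u + deg G v ≤ 5
  cherry_le : ∀ u x y, G.Adj u x → G.Adj u y → x ≠ y → deg G x + 2 * deg G u + deg G y ≤ 9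

/-- If some edge has degree sum at least six, the index is at most two. -/
lemma ind_le_two_of_six_le (hconn : G.Connected) {p q : V} (hpq : G.Adj p q)
    (h6 : 6 ≤ deg G p + deg G q) : ind (fun _ H => chromaticIndex H) G ≤ 2 := by
  have : Nonempty {e : V × V // G.Adj e.1 e.2} := ⟨⟨(p, q), hpq⟩⟩
  obtain ⟨⟨⟨u, v⟩, huv⟩, hmax⟩ := Finite.exists_max
    (fun e : {e : V × V // G.Adj e.1 e.2} => deg G e.1.1 + deg G e.1.2)
  have hmax' : ∀ x y, G.Adj x y → deg G x + deg G y ≤ deg G u + deg G v :=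
    fun x y h => hmax ⟨(x, y), h⟩
  change G.Adj u v at huv
  have hσ := h6.trans (hmax' p q hpq)
  clear hmax
  wlog hvu : deg G v ≤ deg G u generalizing u v
  · refine this v u (fun x y h => ?_) huv.symm (by omega) (by omega)
    have := hmax' x y h
    omega
  by_contra hcon
  have hgreedy : EdgeColorable G (deg G u + deg G v - 1) :=
    edgeColorable_of_forall_le (by omega) fun x y h => by
      have := hmax' x y h
      omega
  -- edges adjacent to an edge of maximum degree sum have degree sum at most five
  have hstep : ∀ a b, G.Adj a b → deg G a + deg G b = deg G u + deg G v →
      ∀ w, G.Adj a w → w ≠ b → deg G a + deg G w ≤ 5 := by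
    intro a b hab hs w hw hwb
    by_contra h
    exact hcon (ind_le_two hgreedy hab hw hwb.symm (by omega))
  -- Edges of maximum sum are now pairwise non-adjacent, which saves a colour. The end `a` must have
  -- degree at least 2 so that the other end has degree at most the number of colours.
  have hheavy : EdgeColorable G (deg G u + deg G v - 2) := by
    refine edgeColorable_of_heavy (by omega) fun a b hab hs => ?_
    have hab' : deg G a + deg G b = deg G u + deg G v := by
      have := hmax' a b hab
      omega
    rcases le_or_gt (deg G a) 1 with ha | ha
    · refine ⟨b, a, Sym2.eq_swap, by omega, fun w hw hwa => ?_⟩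
      have := hstep b a hab.symm (by omega) w hw hwa
      omega
    · refine ⟨a, b, rfl, by omega, fun w hw hwb => ?_⟩
      have := hstep a b hab hab' w hw hwb
      omega
  have hstep' : ∀ a b, G.Adj a b → deg G a + deg G b = deg G u + deg G v →
      ∀ w, G.Adj a w → w ≠ b → deg G a + deg G w ≤ 4 := by
    intro a b hab hs w hw hwb
    by_contra h
    exact hcon (ind_le_two hheavy hab hw hwb.symm (by omega))
  have hu := hstep' u v huv rfl
  have hv := hstep' v u huv.symm (by omega)
  -- A further neighbour `w` of `u` has degree at least 1, and the sum bound 4 gives `deg G u ≤ 3`.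
  -- As `v` has no larger degree and the sum is at least 6, both degrees equal 3 and all other
  -- neighbours are leaves: G is S_{2,2}.
  obtain ⟨w, hw, hwv⟩ := exists_adj_notMem (G := G) (v := u) (l := [v]) (by simp; omega)
  have hw1 := deg_pos hw.symm
  have hw4 := hu w hw (by simpa using hwv)
  have hdu : deg G u = 3 := by omega
  have hdv : deg G v = 3 := by omega
  have hleaf : ∀ x, x ≠ u → x ≠ v → (G.Adj u x ∨ G.Adj v x) → deg G x = 1 := by
    rintro x hxu hxv (h | h)
    · have := hu x h hxv
      have := deg_pos h.symm
      omega
    · have := hv x h hxu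
      have := deg_pos h.symm
      omega
  have hall : ∀ x, x = u ∨ x = v ∨ G.Adj u x ∨ G.Adj v x := by
    refine mem_of_closed hconn (S := {x | x = u ∨ x = v ∨ G.Adj u x ∨ G.Adj v x}) (v := u)
      (Or.inl rfl) ?_
    intro x hx y hxy
    by_cases hxu : x = u
    · subst hxu; exact Or.inr (Or.inr (Or.inl hxy))
    by_cases hxv : x = v
    · subst hxv; exact Or.inr (Or.inr (Or.inr hxy))
    have hux := (hx.resolve_left hxu).resolve_left hxv
    have h1 := hleaf x hxu hxv hux
    rcases hux with h | h
    · left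
      have := mem_of_deg_le (l := [u]) (by simp) (by simpa using h.symm) (by simp [h1]) hxy
      simpa using this
    · right; left
      have := mem_of_deg_le (l := [v]) (by simp) (by simpa using h.symm) (by simp [h1]) hxy
      simpa using this
  have hdeg : ∀ x, x ≠ u → x ≠ v → deg G x = 1 := fun x hxu hxv =>
    hleaf x hxu hxv (((hall x).resolve_left hxu).resolve_left hxv)
  have h3 : EdgeColorable G 3 := by
    refine edgeColorable_of_heavy (by omega) fun a b hab hs => ⟨a, b, rfl, ?_, ?_⟩
    · by_cases hbu : b = u
      · rw [hbu]; omega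
      by_cases hbv : b = v
      · rw [hbv]; omega
      have := hdeg b hbu hbv
      omega
    · intro x hx hxb
      by_cases hau : a = u
      · subst hau
        by_cases hbv : b = v
        · subst hbv; exact hu x hx hxb
        · have := hdeg b hab.ne' hbv
          omega
      by_cases hav : a = v
      · subst hav
        by_cases hbu : b = u
        · subst hbu; exact hv x hx hxb
        · have := hdeg b hbu hab.ne'
          omega
      have := hdeg a hau hav
      by_cases hbu : b = u
      · subst hbu; omega
      by_cases hbv : b = v
      · subst hbv; omega
      have := hdeg b hbu hbv
      omega
  exact hcon ((ind_le_one h3 huv (by omega)).trans (by norm_num))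

/-- Apart from stars and sparse graphs, the index is at most two. -/
lemma ind_le_two_or (hconn : G.Connected) {p : V} (hp : 3 ≤ deg G p) :
    ind (fun _ H => chromaticIndex H) G ≤ 2 ∨
      Nonempty (G ≃g completeBipartiteGraph (Fin 1) (Fin 4)) ∨ IsSparse G := by
  by_contra! hcon
  obtain ⟨hcon, h4, hsp⟩ := hcon
  have h5 : ∀ u v, G.Adj u v → deg G u + deg G v ≤ 5 := by
    intro u v huv
    by_contra h
    exact hcon.not_ge (ind_le_two_of_six_le hconn huv (by omega))
  have h3 : ∀ v, deg G v ≤ 3 := by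
    intro v
    by_contra h
    -- A vertex of degree at least 4 has degree exactly 4 and only leaves as neighbours, because
    -- degree sums are at most 5.
    obtain ⟨w, hw, -⟩ := exists_adj_notMem (G := G) (v := v) (l := []) (by simp; omega)
    have h1 := h5 v w hw
    have h2 := deg_pos hw.symm
    have hd : deg G v = 4 := by omega
    have := nonempty_iso_star hconn hd fun x hx => by
      have := h5 v x hx
      omega
    exact not_isEmpty_iff.2 this h4
  have hcol := edgeColorable_three h3 h5
  refine hsp ⟨h3, ⟨p, le_antisymm (h3 p) hp⟩, h5, fun u x y hx hy hxy => ?_⟩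
  by_contra h
  exact hcon.not_ge (ind_le_two hcol hx hy hxy (by omega))

/-- Since G is not the claw, a cubic vertex has a non-leaf neighbour `v`, of degree 2 by the edge
bound. Then 2 + 2·3 + deg ≤ 9 makes the other two neighbours leaves. -/
lemma IsSparse.exists_leaves (hG : IsSparse G) (hconn : G.Connected)
    (hclaw : IsEmpty (G ≃g completeBipartiteGraph (Fin 1) (Fin 3))) :
    ∃ u a b v, deg G u = 3 ∧ G.Adj u a ∧ G.Adj u b ∧ G.Adj u v ∧ a ≠ b ∧ a ≠ v ∧ b ≠ v ∧
      deg G a = 1 ∧ deg G b = 1 ∧ deg G v = 2 := by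
  obtain ⟨u, hu⟩ := hG.exists_deg
  obtain ⟨v, hv, hv2⟩ : ∃ v, G.Adj u v ∧ ¬ deg G v ≤ 1 := by
    by_contra! h
    exact not_isEmpty_iff.2 (nonempty_iso_star hconn hu h) hclaw
  obtain ⟨a, ha, hav⟩ := exists_adj_notMem (G := G) (v := u) (l := [v]) (by simp; omega)
  obtain ⟨b, hb, hbv⟩ := exists_adj_notMem (G := G) (v := u) (l := [v, a]) (by simp; omega)
  simp only [List.mem_cons, List.not_mem_nil, or_false, not_or] at hav hbv
  have h1 := hG.adj_le u v hv
  have h2 := hG.cherry_le u v a hv ha (Ne.symm hav)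
  have h3 := hG.cherry_le u v b hv hb (Ne.symm hbv.1)
  have h4 := deg_pos ha.symm
  have h5 := deg_pos hb.symm
  exact ⟨u, a, b, v, hu, ha, hb, hv, Ne.symm hbv.2, hav, hbv.1, by omega, by omega, by omega⟩

lemma IsSparse.ind_le_three (hG : IsSparse G) (hconn : G.Connected)
    (hclaw : IsEmpty (G ≃g completeBipartiteGraph (Fin 1) (Fin 3))) :
    ind (fun _ H => chromaticIndex H) G ≤ 3 := by
  obtain ⟨u, a, b, v, hu, ha, hb, hv, hab, hav, hbv, hda, hdb, hdv⟩ := hG.exists_leaves hconn hclaw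
  -- With `v` as the shared neighbour, 3 + 14 = 17 < 18 = 2·2 + 4·3 + 1 + 1.
  exact LineGraphIndex.ind_le_three (edgeColorable_three hG.deg_le hG.adj_le) hv ha hb hav.symm
    hbv.symm hab (by omega)

end Main

/-! ### Maximal paths; paths and cycles as the graphs of maximum degree two. -/

section Paths
variable {V : Type u} {G : SimpleGraph V}

/-- `p 0, …, p n` is a path in `G`. -/
structure IsPathSeq (G : SimpleGraph V) (p : ℕ → V) (n : ℕ) : Prop where
  inj : ∀ i j, i ≤ n → j ≤ n → p i = p j → i = j
  adj : ∀ i, i < n → G.Adj (p i) (p (i + 1))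

lemma IsPathSeq.ne {p : ℕ → V} {n i j : ℕ} (h : IsPathSeq G p n) (hi : i ≤ n) (hj : j ≤ n)
    (hij : i ≠ j) : p i ≠ p j := fun h' => hij (h.inj i j hi hj h')

lemma IsPathSeq.adj' {p : ℕ → V} {n i : ℕ} (h : IsPathSeq G p n) (h0 : 0 < i) (hi : i ≤ n) :
    G.Adj (p i) (p (i - 1)) := by
  have := h.adj (i - 1) (by omega)
  rw [Nat.sub_add_cancel h0] at this
  exact this.symm

variable [Finite V]

/-- Every path extends to one whose last vertex has all its neighbours on the path. -/
lemma IsPathSeq.exists_maximal {p₀ : ℕ → V} {m : ℕ} (h₀ : IsPathSeq G p₀ m) :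
    ∃ p n, m ≤ n ∧ (∀ i ≤ m, p i = p₀ i) ∧ IsPathSeq G p n ∧
      ∀ x, G.Adj (p n) x → ∃ j ≤ n, x = p j := by
  classical
  by_contra! hcon
  have hlong : ∀ k, ∃ p, (∀ i ≤ m, p i = p₀ i) ∧ IsPathSeq G p (m + k) := by
    intro k
    induction k with
    | zero => exact ⟨p₀, fun _ _ => rfl, h₀⟩
    | succ k ih =>
      obtain ⟨p, hp, hseq⟩ := ih
      obtain ⟨x, hx, hx'⟩ := hcon p (m + k) (by omega) hp hseq
      refine ⟨Function.update p (m + k + 1) x, fun i hi => ?_, ⟨fun i j hi hj hij => ?_,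
        fun i hi => ?_⟩⟩
      · rw [Function.update_of_ne (by omega)]
        exact hp i hi
      · by_cases hi' : i = m + k + 1
        · subst hi'
          by_contra hne
          rw [Function.update_self, Function.update_of_ne (Ne.symm hne)] at hij
          exact hx' j (by omega) hij
        · by_cases hj' : j = m + k + 1
          · subst hj'
            rw [Function.update_self, Function.update_of_ne hi'] at hij
            exact absurd hij.symm (hx' i (by omega))
          · rw [Function.update_of_ne hi', Function.update_of_ne hj'] at hij
            exact hseq.inj i j (by omega) (by omega) hij
      · rw [Function.update_of_ne (by omega)]
        by_cases hi' : i = m + k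
        · subst hi'
          rw [Function.update_self]
          exact hx
        · rw [Function.update_of_ne (by omega)]
          exact hseq.adj i (by omega)
  obtain ⟨p, -, hseq⟩ := hlong (Nat.card V)
  have hinj : Function.Injective (fun i : Fin (Nat.card V + 1) => p i) := fun i j hij =>
    Fin.ext (hseq.inj i j (by omega) (by omega) hij)
  have := Nat.card_le_card_of_injective _ hinj
  simp at this

lemma IsPathSeq.eq_of_adj {p : ℕ → V} {n i : ℕ} (h : IsPathSeq G p n) (h0 : 0 < i) (hi : i < n)
    (hd : deg G (p i) ≤ 2) {x : V} (hx : G.Adj (p i) x) : x = p (i - 1) ∨ x = p (i + 1) := by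
  have := mem_of_deg_le (l := [p (i - 1), p (i + 1)])
    (by simpa using h.ne (by omega) (by omega) (by omega))
    (by simpa using ⟨h.adj' h0 hi.le, h.adj i hi⟩) (by simpa using hd) hx
  simpa using this

lemma IsPathSeq.eq_of_adj_zero {p : ℕ → V} {n : ℕ} (h : IsPathSeq G p n) (hn : 0 < n)
    (hd : deg G (p 0) ≤ 1) {x : V} (hx : G.Adj (p 0) x) : x = p 1 := by
  have := mem_of_deg_le (l := [p 1]) (by simp) (by simpa using h.adj 0 hn) (by simpa using hd) hx
  simpa using this

/-- A connected graph of maximum degree two with a vertex of degree at most one is a path. -/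
lemma nonempty_iso_pathGraph (hconn : G.Connected) (h2 : ∀ v, deg G v ≤ 2) {a : V}
    (ha : deg G a ≤ 1) : ∃ n, Nonempty (G ≃g pathGraph n) := by
  have h₀ : IsPathSeq G (fun _ => a) 0 := ⟨fun i j hi hj _ => by omega, fun i hi => by omega⟩
  obtain ⟨p, n, -, hp0, hp, hend⟩ := h₀.exists_maximal
  have hp0 : p 0 = a := hp0 0 le_rfl
  -- Neighbours along the path are consecutive: the start and the inner vertices have no spare
  -- degree, and the last vertex cannot reach back for the same reason.
  have key : ∀ i, i ≤ n → ∀ x, G.Adj (p i) x → ∃ j ≤ n, x = p j ∧ (i + 1 = j ∨ j + 1 = i) := by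
    intro i hi x hx
    rcases Nat.eq_zero_or_pos i with rfl | h0
    · rcases Nat.eq_zero_or_pos n with rfl | hn
      · obtain ⟨j, hj, rfl⟩ := hend x hx
        obtain rfl : j = 0 := by omega
        exact absurd rfl hx.ne
      · exact ⟨1, hn, hp.eq_of_adj_zero hn (hp0 ▸ ha) hx, by simp⟩
    · rcases hi.lt_or_eq with hin | rfl
      · rcases hp.eq_of_adj h0 hin (h2 _) hx with h | h
        · exact ⟨i - 1, by omega, h, by omega⟩
        · exact ⟨i + 1, by omega, h, by omega⟩
      · obtain ⟨j, hj, rfl⟩ := hend x hx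
        refine ⟨j, hj, rfl, ?_⟩
        by_contra hne
        have hji : j ≠ i := by rintro rfl; exact hx.ne rfl
        rcases Nat.eq_zero_or_pos j with rfl | hj0
        · have := hp.eq_of_adj_zero h0 (hp0 ▸ ha) hx.symm
          have := hp.inj i 1 le_rfl (by omega) this
          omega
        · rcases hp.eq_of_adj hj0 (by omega) (h2 _) hx.symm with h | h
          · have := hp.inj _ _ (by omega) (by omega) h
            omega
          · have := hp.inj _ _ (by omega) (by omega) h
            omega
  refine ⟨n + 1, nonempty_iso hconn (fun i : Fin (n + 1) => p i)
    (fun i j hij => Fin.ext (hp.inj i j (by omega) (by omega) hij)) ?_ ?_⟩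
  · intro x y hxy
    rw [pathGraph_adj] at hxy
    rcases hxy with h | h
    · have := hp.adj x (by omega)
      rwa [h] at this
    · have := hp.adj y (by omega)
      rw [h] at this
      exact this.symm
  · intro x v hv
    obtain ⟨j, hj, rfl, h⟩ := key x (by omega) v hv
    exact ⟨⟨j, by omega⟩, pathGraph_adj.2 h, rfl⟩

/-- A connected graph all of whose vertices have degree two is a cycle. -/
lemma nonempty_iso_cycleGraph (hconn : G.Connected) (h2 : ∀ v, deg G v = 2) :
    ∃ n, 3 ≤ n ∧ Nonempty (G ≃g cycleGraph n) := by
  obtain ⟨a⟩ := hconn.nonempty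
  have h₀ : IsPathSeq G (fun _ => a) 0 := ⟨fun i j hi hj _ => by omega, fun i hi => by omega⟩
  obtain ⟨p, n, -, -, hp, hend⟩ := h₀.exists_maximal
  have hn : 2 ≤ n := by
    by_contra hn
    have h3 : ∀ x, G.Adj (p n) x → x ∈ [p (n - 1)] := by
      intro x hx
      obtain ⟨j, hj, rfl⟩ := hend x hx
      have hji : j ≠ n := by rintro rfl; exact hx.ne rfl
      obtain rfl : j = n - 1 := by omega
      simp
    obtain ⟨x, hx, hx'⟩ := exists_adj_notMem (G := G) (v := p n) (l := [p (n - 1)]) (by simp [h2])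
    exact hx' (h3 x hx)
  -- The second neighbour of the last vertex lies on the path, and every inner vertex is already
  -- saturated, so it is `p 0`.
  have hclose : G.Adj (p n) (p 0) := by
    obtain ⟨x, hx, hx'⟩ := exists_adj_notMem (G := G) (v := p n) (l := [p (n - 1)]) (by simp [h2])
    obtain ⟨j, hj, rfl⟩ := hend x hx
    have hji : j ≠ n := by rintro rfl; exact hx.ne rfl
    have hj1 : j ≠ n - 1 := by rintro rfl; simp at hx'
    rcases Nat.eq_zero_or_pos j with rfl | hj0
    · exact hx
    · exfalso
      rcases hp.eq_of_adj hj0 (by omega) (h2 _).le hx.symm with h | h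
      · have := hp.inj _ _ (by omega) (by omega) h
        omega
      · have := hp.inj _ _ (by omega) (by omega) h
        omega
  have key : ∀ i, i ≤ n → ∀ x, G.Adj (p i) x →
      ∃ j ≤ n, x = p j ∧ (i + 1 = j ∨ j + 1 = i ∨ (i = 0 ∧ j = n) ∨ (i = n ∧ j = 0)) := by
    intro i hi x hx
    rcases Nat.eq_zero_or_pos i with rfl | h0
    · have := mem_of_deg_le (l := [p 1, p n])
        (by simpa using hp.ne (by omega) le_rfl (by omega))
        (by simpa using ⟨hp.adj 0 (by omega), hclose.symm⟩) (by simp [h2]) hx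
      rcases List.mem_pair.1 this with rfl | rfl
      · exact ⟨1, by omega, rfl, by omega⟩
      · exact ⟨n, by omega, rfl, by omega⟩
    · rcases hi.lt_or_eq with hin | rfl
      · rcases hp.eq_of_adj h0 hin (h2 _).le hx with h | h
        · exact ⟨i - 1, by omega, h, by omega⟩
        · exact ⟨i + 1, by omega, h, by omega⟩
      · have := mem_of_deg_le (l := [p (i - 1), p 0])
          (by simpa using hp.ne (by omega) (by omega) (by omega))
          (by simpa using ⟨hp.adj' h0 le_rfl, hclose⟩) (by simp [h2]) hx
        rcases List.mem_pair.1 this with rfl | rfl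
        · exact ⟨i - 1, by omega, rfl, by omega⟩
        · exact ⟨0, by omega, rfl, by omega⟩
  have hcyc : ∀ x y : Fin (n + 1), (cycleGraph (n + 1)).Adj x y ↔
      (x.1 + 1 = y.1 ∨ y.1 + 1 = x.1 ∨ (x.1 = 0 ∧ y.1 = n) ∨ (x.1 = n ∧ y.1 = 0)) := by
    intro x y
    have hx := x.2
    have hy := y.2
    rw [cycleGraph_adj']
    rcases le_or_gt x y with hxy | hxy
    · rw [Fin.coe_sub_iff_le.2 hxy]
      rcases hxy.lt_or_eq with hlt | rfl
      · rw [Fin.coe_sub_iff_lt.2 hlt]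
        have := Fin.lt_def.1 hlt
        omega
      · rw [Fin.coe_sub_iff_le.2 le_rfl]
        omega
    · rw [Fin.coe_sub_iff_le.2 hxy.le, Fin.coe_sub_iff_lt.2 hxy]
      have := Fin.lt_def.1 hxy
      omega
  refine ⟨n + 1, by omega, nonempty_iso hconn (fun i : Fin (n + 1) => p i)
    (fun i j hij => Fin.ext (hp.inj i j (by omega) (by omega) hij)) ?_ ?_⟩
  · intro x y hxy
    rcases (hcyc x y).1 hxy with h | h | ⟨h, h'⟩ | ⟨h, h'⟩
    · have := hp.adj x (by omega)
      rwa [h] at this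
    · have := hp.adj y (by omega)
      rw [h] at this
      exact this.symm
    · rw [h, h']; exact hclose.symm
    · rw [h, h']; exact hclose
  · intro x v hv
    obtain ⟨j, hj, rfl, h⟩ := key x (by omega) v hv
    exact ⟨⟨j, by omega⟩, (hcyc _ _).2 h, rfl⟩

lemma IsProlific.exists_three_le_deg (hG : IsProlific G) : ∃ v, 3 ≤ deg G v := by
  by_contra! h
  have h2 : ∀ v, deg G v ≤ 2 := fun v => by have := h v; omega
  by_cases h1 : ∃ a, deg G a ≤ 1
  · obtain ⟨a, ha⟩ := h1
    obtain ⟨n, hn⟩ := nonempty_iso_pathGraph hG.connected h2 ha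
    exact not_isEmpty_iff.2 hn (hG.not_path n)
  · push Not at h1
    obtain ⟨n, h3, hn⟩ := nonempty_iso_cycleGraph hG.connected fun v => by
      have := h1 v
      have := h2 v
      omega
    exact not_isEmpty_iff.2 hn (hG.not_cycle n h3)

end Paths

/-! ### Subdivided claws and type A. -/

section Sparse
variable {V : Type u} {G : SimpleGraph V}

lemma clawSubdivision_adj_none {a : Fin 3 → ℕ} (q : (i : Fin 3) × Fin (a i + 1)) :
    (clawSubdivision a).Adj none (some q) ↔ q.2.val = 0 := by
  simp [clawSubdivision]

lemma clawSubdivision_adj_none' {a : Fin 3 → ℕ} (q : (i : Fin 3) × Fin (a i + 1)) :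
    (clawSubdivision a).Adj (some q) none ↔ q.2.val = 0 := by
  simp [clawSubdivision]

lemma clawSubdivision_adj_some {a : Fin 3 → ℕ} (p q : (i : Fin 3) × Fin (a i + 1)) :
    (clawSubdivision a).Adj (some p) (some q) ↔
      p.1 = q.1 ∧ (p.2.val + 1 = q.2.val ∨ q.2.val + 1 = p.2.val) := by
  simp only [clawSubdivision, fromRel_adj, ne_eq, Option.some.injEq]
  constructor
  · rintro ⟨-, ⟨h1, h2⟩ | ⟨h1, h2⟩⟩
    · exact ⟨h1, Or.inl h2⟩
    · exact ⟨h1.symm, Or.inr h2⟩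
  · rintro ⟨h1, h2⟩
    refine ⟨?_, ?_⟩
    · rintro rfl
      omega
    · rcases h2 with h2 | h2
      · exact Or.inl ⟨h1, h2⟩
      · exact Or.inr ⟨h1.symm, h2⟩

/-- The neighbour of the centre of a subdivided claw on a given leg is a leaf exactly if
that leg is not subdivided. -/
lemma ncard_neighborSet_clawSubdivision {a : Fin 3 → ℕ} (i : Fin 3) :
    ((clawSubdivision a).neighborSet (some ⟨i, 0⟩)).ncard = 1 ↔ a i = 0 := by
  rcases Nat.eq_zero_or_pos (a i) with h | h
  · simp only [h, iff_true]
    rw [Set.ncard_eq_one]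
    refine ⟨none, ?_⟩
    ext (_ | ⟨j, m, hm⟩)
    · simp [clawSubdivision_adj_none']
    · simp only [mem_neighborSet, clawSubdivision_adj_some, Set.mem_singleton_iff, reduceCtorEq,
        iff_false]
      rintro ⟨h1, h2⟩
      subst h1
      simp at h2
      omega
  · refine iff_of_false ?_ h.ne'
    intro h1
    obtain ⟨x, hx⟩ := Set.ncard_eq_one.1 h1
    have h2 : (none : Option ((i : Fin 3) × Fin (a i + 1))) ∈
        (clawSubdivision a).neighborSet (some ⟨i, 0⟩) := by
      simp [clawSubdivision_adj_none']
    have h3 : some ⟨i, ⟨1, by omega⟩⟩ ∈ (clawSubdivision a).neighborSet (some ⟨i, 0⟩) := by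
      simp [clawSubdivision_adj_some]
    rw [hx] at h2 h3
    exact absurd (h2.trans h3.symm) (by simp)

lemma clawSubdivision_leaves (a : Fin 3 → ℕ) :
    {x | (clawSubdivision a).Adj none x ∧ ((clawSubdivision a).neighborSet x).ncard = 1} =
      (fun i => some ⟨i, 0⟩) '' {i | a i = 0} := by
  ext (_ | ⟨i, m, hm⟩)
  · simp
  · simp only [Set.mem_ofPred_eq, clawSubdivision_adj_none, Set.mem_image]
    constructor
    · rintro ⟨rfl, h⟩
      exact ⟨i, (ncard_neighborSet_clawSubdivision i).1 h, rfl⟩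
    · rintro ⟨j, hj, h⟩
      simp only [Option.some.injEq, Sigma.mk.injEq] at h
      obtain ⟨rfl, h⟩ := h
      rw [heq_eq_eq] at h
      have h' : 0 = m := congrArg Fin.val h
      subst h'
      exact ⟨rfl, (ncard_neighborSet_clawSubdivision j).2 hj⟩

/-- Turns type A into a condition on `a`: exactly two legs are unsubdivided. -/
lemma ncard_clawSubdivision_leaves (a : Fin 3 → ℕ) :
    {x | (clawSubdivision a).Adj none x ∧
      ((clawSubdivision a).neighborSet x).ncard = 1}.ncard = {i | a i = 0}.ncard := by
  rw [clawSubdivision_leaves, Set.ncard_image_of_injective]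
  intro i j h
  simp only [Option.some.injEq, Sigma.mk.injEq] at h
  exact h.1

/-- A path `p 0, …, p n` together with a further leaf `b` at `p 1` is a subdivided claw. -/
lemma isTypeA_of_path (hconn : G.Connected) {p : ℕ → V} {n : ℕ} (hp : IsPathSeq G p n)
    (hn : 3 ≤ n) {b : V} (hb : ∀ i ≤ n, p i ≠ b)
    (h0 : ∀ x, G.Adj (p 0) x ↔ x = p 1) (h1 : ∀ x, G.Adj (p 1) x ↔ x = p 0 ∨ x = b ∨ x = p 2)
    (hbx : ∀ x, G.Adj b x ↔ x = p 1)
    (hi : ∀ i, 2 ≤ i → i < n → ∀ x, G.Adj (p i) x → x = p (i - 1) ∨ x = p (i + 1))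
    (hend : ∀ x, G.Adj (p n) x → x = p (n - 1)) : IsTypeA G := by
  have hinj : ∀ i j, i ≤ n → j ≤ n → (p i = p j ↔ i = j) := fun i j hi hj =>
    ⟨hp.inj i j hi hj, fun h => h ▸ rfl⟩
  -- The centre is `p 1`, the short legs are `p 0` and `b`, and the long leg is `p 2, …, p n`, with
  -- `n - 1` vertices.
  refine ⟨![0, 0, n - 2], nonempty_iso hconn (fun x => match x with
    | none => p 1
    | some ⟨0, _⟩ => p 0
    | some ⟨1, _⟩ => b
    | some ⟨2, j⟩ => p (j.val + 2)) ?_ ?_ ?_, ?_⟩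
  · rintro (_ | ⟨i, m, hm⟩) (_ | ⟨j, l, hl⟩) h
    · rfl
    · exfalso
      fin_cases j <;> simp at hl h
      · exact hp.ne (by omega) (by omega) (by omega) h
      · exact hb _ (by omega) h
      · exact hp.ne (by omega) (by omega) (by omega) h
    · exfalso
      fin_cases i <;> simp at hm h
      · exact hp.ne (by omega) (by omega) (by omega) h
      · exact hb _ (by omega) h.symm
      · exact hp.ne (by omega) (by omega) (by omega) h
    · fin_cases i <;> fin_cases j <;> simp at hm hl h
      · subst hm hl; rfl
      · exact absurd h (hb _ (by omega))
      · exact absurd h (hp.ne (by omega) (by omega) (by omega))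
      · exact absurd h.symm (hb _ (by omega))
      · subst hm hl; rfl
      · exact absurd h.symm (hb _ (by omega))
      · exact absurd h (hp.ne (by omega) (by omega) (by omega))
      · exact absurd h (hb _ (by omega))
      · rw [hinj _ _ (by omega) (by omega)] at h
        obtain rfl : m = l := by omega
        rfl
  · have hc : ∀ q : (i : Fin 3) × Fin (![0, 0, n - 2] i + 1), q.2.val = 0 →
        G.Adj (p 1) (match some q with
          | none => p 1
          | some ⟨0, _⟩ => p 0
          | some ⟨1, _⟩ => b
          | some ⟨2, j⟩ => p (j.val + 2)) := by
      rintro ⟨i, m, hm⟩ h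
      dsimp only at h
      subst h
      fin_cases i
      · exact (h1 _).2 (Or.inl rfl)
      · exact (h1 _).2 (Or.inr (Or.inl rfl))
      · exact (h1 _).2 (Or.inr (Or.inr rfl))
    rintro (_ | q) (_ | q') h
    · exact absurd h (SimpleGraph.irrefl _)
    · exact hc q' ((clawSubdivision_adj_none _).1 h)
    · exact (hc q ((clawSubdivision_adj_none' _).1 h)).symm
    · obtain ⟨i, m, hm⟩ := q
      obtain ⟨j, l, hl⟩ := q'
      obtain ⟨h2, h3⟩ := (clawSubdivision_adj_some _ _).1 h
      dsimp only at h2 h3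
      subst h2
      fin_cases i <;> simp at hm hl
      · omega
      · omega
      · rcases h3 with h3 | h3
        · subst h3
          exact (hp.adj (m + 2) (by omega) : G.Adj (p (m + 2)) (p (m + 2 + 1))) |> fun h => by
            simpa [add_right_comm] using h
        · subst h3
          exact (hp.adj (l + 2) (by omega) : G.Adj (p (l + 2)) (p (l + 2 + 1))).symm |> fun h => by
            simpa [add_right_comm] using h
  · rintro (_ | ⟨i, m, hm⟩) v hv
    · rcases (h1 v).1 hv with rfl | rfl | rfl
      · exact ⟨some ⟨0, 0⟩, (clawSubdivision_adj_none _).2 rfl, rfl⟩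
      · exact ⟨some ⟨1, 0⟩, (clawSubdivision_adj_none _).2 rfl, rfl⟩
      · exact ⟨some ⟨2, 0⟩, (clawSubdivision_adj_none _).2 rfl, rfl⟩
    · fin_cases i
      · simp at hm
        subst hm
        exact ⟨none, (clawSubdivision_adj_none' _).2 rfl, ((h0 v).1 hv).symm⟩
      · simp at hm
        subst hm
        exact ⟨none, (clawSubdivision_adj_none' _).2 rfl, ((hbx v).1 hv).symm⟩
      · have hm' : m < n - 2 + 1 := hm
        have hv' : G.Adj (p (m + 2)) v := hv
        have hdown : v = p (m + 1) → ∃ y, (clawSubdivision ![0, 0, n - 2]).Adj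
            (some ⟨2, m, hm⟩) y ∧ (match y with
              | none => p 1
              | some ⟨0, _⟩ => p 0
              | some ⟨1, _⟩ => b
              | some ⟨2, j⟩ => p (j.val + 2)) = v := by
          rintro rfl
          rcases Nat.eq_zero_or_pos m with rfl | hm0
          · exact ⟨none, (clawSubdivision_adj_none' _).2 rfl, rfl⟩
          · refine ⟨some ⟨2, m - 1, by change m - 1 < n - 2 + 1; omega⟩, (clawSubdivision_adj_some _ _).2
              ⟨rfl, Or.inr (by dsimp only; omega)⟩, ?_⟩
            change p (m - 1 + 2) = p (m + 1)
            congr 1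
            omega
        by_cases hmn : m + 2 < n
        · rcases hi (m + 2) (by omega) hmn v hv' with h | h
          · exact hdown h
          · refine ⟨some ⟨2, m + 1, by change m + 1 < n - 2 + 1; omega⟩,
              (clawSubdivision_adj_some _ _).2 ⟨rfl, Or.inl rfl⟩, ?_⟩
            rw [h]
        · obtain rfl : n = m + 2 := by omega
          exact hdown (hend v hv')
  · rw [ncard_clawSubdivision_leaves]
    have : {i : Fin 3 | (![0, 0, n - 2] : Fin 3 → ℕ) i = 0} = {0, 1} := by
      ext i
      fin_cases i <;> simp
      omega
    rw [this]
    exact Set.ncard_pair (by decide)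

end Sparse

/-! ### Subdivided double stars and the classification of sparse graphs. -/

section Double
variable {V : Type u} {G : SimpleGraph V}

lemma doubleStar22_adj (a b : Fin 6) : doubleStar22.Adj a b ↔ s(a, b) = s(0, 1) ∨
    (a = 0 ∧ (b = 2 ∨ b = 3)) ∨ (b = 0 ∧ (a = 2 ∨ a = 3)) ∨
    (a = 1 ∧ (b = 4 ∨ b = 5)) ∨ (b = 1 ∧ (a = 4 ∨ a = 5)) := by
  simp only [doubleStar22, fromEdgeSet_adj, Set.mem_insert_iff, Set.mem_singleton_iff]
  revert a b
  decide

lemma subdivided_inl_inl {k : ℕ} (hk : 0 < k) (a b : Fin 6) :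
    (subdivideEdge doubleStar22 0 1 k).Adj (Sum.inl a) (Sum.inl b) ↔
    (a = 0 ∧ (b = 2 ∨ b = 3)) ∨ (b = 0 ∧ (a = 2 ∨ a = 3)) ∨
    (a = 1 ∧ (b = 4 ∨ b = 5)) ∨ (b = 1 ∧ (a = 4 ∨ a = 5)) := by
  simp only [subdivideEdge, fromRel_adj, ne_eq, Sum.inl.injEq, doubleStar22_adj, hk.ne', imp_false]
  revert a b
  decide

lemma subdivided_inl_inr {k : ℕ} (a : Fin 6) (i : Fin k) :
    (subdivideEdge doubleStar22 0 1 k).Adj (Sum.inl a) (Sum.inr i) ↔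
    (a = 0 ∧ i.val = 0) ∨ (a = 1 ∧ i.val + 1 = k) := by
  simp [subdivideEdge]

lemma subdivided_inr_inl {k : ℕ} (a : Fin 6) (i : Fin k) :
    (subdivideEdge doubleStar22 0 1 k).Adj (Sum.inr i) (Sum.inl a) ↔
    (a = 0 ∧ i.val = 0) ∨ (a = 1 ∧ i.val + 1 = k) := by
  simp [subdivideEdge]

lemma subdivided_inr_inr {k : ℕ} (i j : Fin k) :
    (subdivideEdge doubleStar22 0 1 k).Adj (Sum.inr i) (Sum.inr j) ↔
    i.val + 1 = j.val ∨ j.val + 1 = i.val := by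
  simp only [subdivideEdge, fromRel_adj, ne_eq, Sum.inr.injEq, and_iff_right_iff_imp]
  rintro h rfl
  omega

/-- A path `p 0, …, p n` with further leaves `b` at `p 1` and `b'` at `p (n - 1)` is a double star
with subdivided middle edge. -/
lemma nonempty_iso_subdivideEdge (hconn : G.Connected) {p : ℕ → V} {k : ℕ}
    (hp : IsPathSeq G p (k + 3)) (hk : 2 ≤ k) {b b' : V} (hb : ∀ i ≤ k + 3, p i ≠ b)
    (hb' : ∀ i ≤ k + 3, p i ≠ b') (hbb : b ≠ b')
    (h0 : ∀ x, G.Adj (p 0) x ↔ x = p 1) (h1 : ∀ x, G.Adj (p 1) x ↔ x = p 0 ∨ x = b ∨ x = p 2)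
    (hbx : ∀ x, G.Adj b x ↔ x = p 1)
    (hi : ∀ i, 2 ≤ i → i < k + 2 → ∀ x, G.Adj (p i) x → x = p (i - 1) ∨ x = p (i + 1))
    (hend : ∀ x, G.Adj (p (k + 3)) x ↔ x = p (k + 2))
    (h1' : ∀ x, G.Adj (p (k + 2)) x ↔ x = p (k + 3) ∨ x = b' ∨ x = p (k + 1))
    (hbx' : ∀ x, G.Adj b' x ↔ x = p (k + 2)) :
    Nonempty (G ≃g subdivideEdge doubleStar22 0 1 k) := by
  have hk0 : 0 < k := by omega
  have hinj : ∀ i j, i ≤ k + 3 → j ≤ k + 3 → (p i = p j ↔ i = j) := fun i j hi hj =>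
    ⟨hp.inj i j hi hj, fun h => h ▸ rfl⟩
  -- The centres are `p 1` and `p (k + 2)`; the `k` inner vertices are `p 2, …, p (k + 1)`.
  let f : Fin 6 ⊕ Fin k → V := Sum.elim ![p 1, p (k + 2), p 0, b, p (k + 3), b'] (fun i => p (i + 2))
  have hb2 : ∀ i ≤ k + 3, b ≠ p i := fun i hi => (hb i hi).symm
  have hb2' : ∀ i ≤ k + 3, b' ≠ p i := fun i hi => (hb' i hi).symm
  have f0 : f (Sum.inl 0) = p 1 := rfl
  have f1 : f (Sum.inl 1) = p (k + 2) := rfl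
  have f2 : f (Sum.inl 2) = p 0 := rfl
  have f3 : f (Sum.inl 3) = b := rfl
  have f4 : f (Sum.inl 4) = p (k + 3) := rfl
  have f5 : f (Sum.inl 5) = b' := rfl
  have fr : ∀ i, f (Sum.inr i) = p (i.val + 2) := fun _ => rfl
  have hlr : ∀ (a : Fin 6) (i : Fin k), f (Sum.inl a) ≠ f (Sum.inr i) := by
    intro a i
    have := i.2
    fin_cases a
    · exact hp.ne (by omega) (by omega) (by omega)
    · exact hp.ne (by omega) (by omega) (by omega)
    · exact hp.ne (by omega) (by omega) (by omega)
    · exact hb2 _ (by omega)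
    · exact hp.ne (by omega) (by omega) (by omega)
    · exact hb2' _ (by omega)
  refine nonempty_iso hconn f ?_ ?_ ?_
  · rintro (a | i) (c | j) h
    · congr 1
      by_contra hne
      wlog hlt : a < c generalizing a c
      · exact this c a h.symm (Ne.symm hne) (lt_of_le_of_ne (not_lt.1 hlt) (Ne.symm hne))
      clear hne
      fin_cases a <;> fin_cases c <;> first
        | exact absurd hlt (by decide)
        | exact hp.ne (by omega) (by omega) (by omega) h
        | exact hb _ (by omega) h
        | exact hb2 _ (by omega) h
        | exact hb' _ (by omega) h
        | exact hbb h
    · exact absurd h (hlr a j)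
    · exact absurd h.symm (hlr c i)
    · have := hp.inj _ _ (by have := i.2; omega) (by have := j.2; omega) h
      congr 1
      exact Fin.ext (by omega)
  · have hll : ∀ a i, (subdivideEdge doubleStar22 0 1 k).Adj (Sum.inl a) (Sum.inr i) →
        G.Adj (f (Sum.inl a)) (f (Sum.inr i)) := by
      intro a i h
      rcases (subdivided_inl_inr a i).1 h with ⟨rfl, h'⟩ | ⟨rfl, h'⟩
      · rw [f0, fr, h']
        exact (h1 _).2 (by simp)
      · rw [f1, fr, h1']
        right; right
        congr 1
        omega
    rintro (a | i) (c | j) h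
    · rcases (subdivided_inl_inl hk0 a c).1 h with ⟨rfl, rfl | rfl⟩ | ⟨rfl, rfl | rfl⟩ |
        ⟨rfl, rfl | rfl⟩ | ⟨rfl, rfl | rfl⟩
      · exact (h1 _).2 (by simp [f2])
      · exact (h1 _).2 (by simp [f3])
      · exact (h0 _).2 f0
      · exact (hbx _).2 f0
      · exact (h1' _).2 (by simp [f4])
      · exact (h1' _).2 (by simp [f5])
      · exact (hend _).2 f1
      · exact (hbx' _).2 f1
    · exact hll a j h
    · exact (hll c i h.symm).symm
    · have := i.2
      have := j.2
      rw [fr, fr]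
      rcases (subdivided_inr_inr i j).1 h with h | h
      · have := hp.adj (i + 2) (by omega)
        rwa [show i.val + 2 + 1 = j.val + 2 by omega] at this
      · have := hp.adj (j + 2) (by omega)
        rw [show j.val + 2 + 1 = i.val + 2 by omega] at this
        exact this.symm
  · rintro (a | i) v hv
    · have hcases : ∀ a : Fin 6, a = 0 ∨ a = 1 ∨ a = 2 ∨ a = 3 ∨ a = 4 ∨ a = 5 := by decide
      rcases hcases a with rfl | rfl | rfl | rfl | rfl | rfl
      · rcases (h1 v).1 hv with rfl | rfl | rfl
        · exact ⟨Sum.inl 2, by simp [subdivided_inl_inl hk0], f2⟩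
        · exact ⟨Sum.inl 3, by simp [subdivided_inl_inl hk0], f3⟩
        · exact ⟨Sum.inr ⟨0, hk0⟩, by simp [subdivided_inl_inr], rfl⟩
      · rcases (h1' v).1 hv with rfl | rfl | rfl
        · exact ⟨Sum.inl 4, by simp [subdivided_inl_inl hk0], f4⟩
        · exact ⟨Sum.inl 5, by simp [subdivided_inl_inl hk0], f5⟩
        · refine ⟨Sum.inr ⟨k - 1, by omega⟩, ?_, ?_⟩
          · rw [subdivided_inl_inr]
            exact Or.inr ⟨rfl, by dsimp only; omega⟩
          · rw [fr]
            congr 1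
            dsimp only
            omega
      · exact ⟨Sum.inl 0, by simp [subdivided_inl_inl hk0], ((h0 v).1 hv).symm⟩
      · exact ⟨Sum.inl 0, by simp [subdivided_inl_inl hk0], ((hbx v).1 hv).symm⟩
      · exact ⟨Sum.inl 1, by simp [subdivided_inl_inl hk0], ((hend v).1 hv).symm⟩
      · exact ⟨Sum.inl 1, by simp [subdivided_inl_inl hk0], ((hbx' v).1 hv).symm⟩
    · obtain ⟨i, hik⟩ := i
      rcases hi (i + 2) (by omega) (by omega) v hv with rfl | rfl
      · rcases Nat.eq_zero_or_pos i with rfl | h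
        · exact ⟨Sum.inl 0, by simp [subdivided_inr_inl], rfl⟩
        · refine ⟨Sum.inr ⟨i - 1, by omega⟩, ?_, ?_⟩
          · rw [subdivided_inr_inr]
            exact Or.inr (by dsimp only; omega)
          · rw [fr]
            congr 1
            dsimp only
            omega
      · rcases Nat.lt_or_ge (i + 1) k with h | h
        · refine ⟨Sum.inr ⟨i + 1, h⟩, ?_, rfl⟩
          rw [subdivided_inr_inr]
          exact Or.inl rfl
        · obtain rfl : k = i + 1 := by omega
          exact ⟨Sum.inl 1, by simp [subdivided_inr_inl], rfl⟩

variable [Finite V]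

/-- The classification of sparse graphs. -/
lemma IsSparse.classification (hG : IsSparse G) (hconn : G.Connected)
    (hclaw : IsEmpty (G ≃g completeBipartiteGraph (Fin 1) (Fin 3))) :
    IsTypeA G ∨ ∃ k : ℕ, 2 ≤ k ∧ Nonempty (G ≃g subdivideEdge doubleStar22 0 1 k) := by
  obtain ⟨u, a, b, v, hu, ha, hb, hv, hab, hav, hbv, hda, hdb, hdv⟩ := hG.exists_leaves hconn hclaw
  -- Start with leaf, cubic vertex, neighbour of degree 2, and extend as far as possible.
  have h₀ : IsPathSeq G (fun i => if i = 0 then a else if i = 1 then u else v) 2 := by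
    refine ⟨fun i j hi hj h => ?_, fun i hi => ?_⟩
    · interval_cases i <;> interval_cases j <;> simp at h ⊢
      · exact ha.ne h.symm
      · exact hav h
      · exact ha.ne h
      · exact hv.ne h
      · exact hav h.symm
      · exact hv.ne h.symm
    · interval_cases i
      · simpa using ha.symm
      · simpa using hv
  obtain ⟨p, n, hn, hp₀, hp, hend⟩ := h₀.exists_maximal
  have hp0 : p 0 = a := by simpa using hp₀ 0 (by omega)
  have hp1 : p 1 = u := by simpa using hp₀ 1 (by omega)
  have hp2 : p 2 = v := by simpa using hp₀ 2 (by omega)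
  clear hp₀ h₀
  subst hp0 hp1 hp2
  have leaf : ∀ x y, deg G x = 1 → G.Adj x y → ∀ z, G.Adj x z ↔ z = y := by
    intro x y hx hxy z
    refine ⟨fun hz => ?_, fun h => h ▸ hxy⟩
    simpa using mem_of_deg_le (l := [y]) (by simp) (by simpa using hxy) (by simp [hx]) hz
  have cubic : ∀ x, deg G x = 3 → ∀ y z w, y ≠ z → y ≠ w → z ≠ w → G.Adj x y → G.Adj x z →
      G.Adj x w → ∀ t, G.Adj x t ↔ t = y ∨ t = z ∨ t = w := by
    intro x hx y z w hyz hyw hzw hy hz hw t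
    refine ⟨fun ht => ?_, ?_⟩
    · simpa using mem_of_deg_le (l := [y, z, w]) (by simp [hyz, hyw, hzw])
        (by simp [hy, hz, hw]) (by simp [hx]) ht
    · rintro (rfl | rfl | rfl) <;> assumption
  have h0 := leaf _ _ hda ha.symm
  have hbx := leaf _ _ hdb hb.symm
  have h1 := cubic _ hu _ _ _ hab hav hbv ha hb hv
  have hn3 : 3 ≤ n := by
    by_contra h
    obtain rfl : n = 2 := by omega
    obtain ⟨x, hx, hx'⟩ := exists_adj_notMem (G := G) (v := p 2) (l := [p 1]) (by simp [hdv])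
    obtain ⟨j, hj, rfl⟩ := hend x hx
    interval_cases j
    · exact hp.ne (i := 1) (j := 2) (by omega) (by omega) (by omega) ((h0 _).1 hx.symm).symm
    · simp at hx'
    · exact hx.ne rfl
  have hinner : ∀ i, 1 ≤ i → i < n → 2 ≤ deg G (p i) := fun i h1 hi =>
    length_le_deg (l := [p (i - 1), p (i + 1)])
      (by simpa using hp.ne (by omega) (by omega) (by omega))
      (by simpa using ⟨hp.adj' h1 hi.le, hp.adj i hi⟩)
  -- a further leaf on the path can only be its last vertex
  have hoff : ∀ x, deg G x = 1 → x ≠ p 0 → x ≠ p n → ∀ i ≤ n, p i ≠ x := by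
    rintro x hx hx0 hxn i hi rfl
    have : i ≠ 0 := by rintro rfl; exact hx0 rfl
    have : i ≠ n := by rintro rfl; exact hxn rfl
    have := hinner i (by omega) (by omega)
    omega
  -- a cubic vertex beyond `p 1` is the last but one, and its further neighbour is a leaf
  have hcubic : ∀ i, 2 ≤ i → i < n → deg G (p i) ≠ 2 →
      i + 1 = n ∧ deg G (p n) = 1 ∧ ∃ c, deg G c = 1 ∧ G.Adj (p i) c ∧ c ≠ p (i - 1) ∧ c ≠ p n := by
    intro i hi hin hd
    have hd3 : deg G (p i) = 3 := by
      have := hinner i (by omega) hin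
      have := hG.deg_le (p i)
      omega
    -- The predecessor has degree at least 2, so the cherry bound 9 makes the other two neighbours
    -- leaves. Hence the path stops at the next vertex.
    have hprev := hinner (i - 1) (by omega) (by omega)
    have hadj := hp.adj' (by omega) hin.le
    have hnext := hG.cherry_le _ _ _ hadj (hp.adj i hin) (hp.ne (by omega) (by omega) (by omega))
    have hpos := deg_pos (hp.adj i hin).symm
    obtain ⟨c, hc, hc'⟩ := exists_adj_notMem (G := G) (v := p i) (l := [p (i - 1), p (i + 1)])
      (by simp [hd3])
    simp only [List.mem_cons, List.not_mem_nil, or_false, not_or] at hc'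
    have hcc := hG.cherry_le _ _ _ hadj hc (Ne.symm hc'.1)
    have hcpos := deg_pos hc.symm
    have hlast : i + 1 = n := by
      by_contra hne
      have := hinner (i + 1) (by omega) (by omega)
      omega
    refine ⟨hlast, ?_, c, by omega, hc, hc'.1, ?_⟩
    · rw [← hlast]; omega
    · rw [← hlast]; exact hc'.2
  -- Another neighbour of the last vertex would be an earlier path vertex `p j`, but each candidate
  -- already has all its neighbours elsewhere.
  have hdn : deg G (p n) = 1 := by
    by_contra hne
    have hpos := deg_pos (hp.adj' (i := n) (by omega) le_rfl)
    obtain ⟨x, hx, hx'⟩ := exists_adj_notMem (G := G) (v := p n) (l := [p (n - 1)])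
      (by simp; omega)
    obtain ⟨j, hj, rfl⟩ := hend x hx
    have hjn : j ≠ n := by rintro rfl; exact hx.ne rfl
    have hjn1 : j ≠ n - 1 := by rintro rfl; simp at hx'
    have hj01 : j ≠ 0 := by
      rintro rfl
      exact hp.ne (by omega) (by omega) (by omega : n ≠ 1) ((h0 _).1 hx.symm)
    have hj1 : j ≠ 1 := by
      rintro rfl
      rcases (h1 _).1 hx.symm with h | h | h
      · exact hp.ne (by omega) (by omega) (by omega) h
      · exact hne (h ▸ hdb)
      · exact hp.ne (by omega) (by omega) (by omega) h
    have hj2 : deg G (p j) = 2 := by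
      by_contra h
      have := (hcubic j (by omega) (by omega) h).1
      omega
    rcases hp.eq_of_adj (by omega) (by omega) hj2.le hx.symm with h | h
    · exact hp.ne (by omega) (by omega) (by omega) h
    · exact hp.ne (by omega) (by omega) (by omega) h
  have hendx := leaf _ _ hdn (hp.adj' (by omega) le_rfl)
  have hbn : b ≠ p n := by
    rintro rfl
    exact hp.ne (by omega) (by omega) (by omega : 1 ≠ n - 1) ((hendx _).1 hb.symm)
  have hboff := hoff b hdb hab.symm hbn
  have hi2 : ∀ i, 2 ≤ i → i + 1 < n → ∀ x, G.Adj (p i) x → x = p (i - 1) ∨ x = p (i + 1) := by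
    intro i hi hin x hx
    refine hp.eq_of_adj (by omega) (by omega) ?_ hx
    by_contra h
    have := (hcubic i hi (by omega) (by omega)).1
    omega
  by_cases hd : deg G (p (n - 1)) = 2
  · refine Or.inl (isTypeA_of_path hconn hp hn3 hboff h0 h1 hbx (fun i hi hin x hx => ?_)
      fun x hx => (hendx x).1 hx)
    by_cases hin' : i + 1 = n
    · obtain rfl : i = n - 1 := by omega
      exact hp.eq_of_adj (by omega) hin hd.le hx
    · exact hi2 i hi (by omega) x hx
  · right
    -- The next bounds on `n` give `k = n - 3 ≥ 2`. For `n = 3` the vertex `p (n - 1)` would be `p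
    -- 2`, of degree 2; for `n = 4` the vertex `p 2` would lie between two cubic vertices, and 3 +
    -- 2·2 + 3 > 9.
    have hn4 : n ≠ 3 := by rintro rfl; exact hd hdv
    obtain ⟨-, -, c, hdc, hc, hcp, hcn⟩ := hcubic (n - 1) (by omega) (by omega) hd
    have hd3 : deg G (p (n - 1)) = 3 := by
      have := hinner (n - 1) (by omega) (by omega)
      have := hG.deg_le (p (n - 1))
      omega
    have hn5 : n ≠ 4 := by
      rintro rfl
      have := hG.cherry_le (p 2) (p 1) (p 3) hv.symm (hp.adj 2 (by omega))
        (hp.ne (by omega) (by omega) (by omega))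
      have h : deg G (p 3) = 3 := hd3
      omega
    obtain ⟨k, rfl⟩ : ∃ k, n = k + 3 := ⟨n - 3, by omega⟩
    have hcx := leaf _ _ hdc hc.symm
    have hc0 : c ≠ p 0 := by
      rintro rfl
      exact hp.ne (by omega) (by omega) (by omega) ((hcx _).1 ha.symm)
    have hbc : b ≠ c := by
      rintro rfl
      exact hp.ne (by omega) (by omega) (by omega) ((hcx _).1 hb.symm)
    have hcoff := hoff c hdc hc0 hcn
    refine ⟨k, by omega, nonempty_iso_subdivideEdge hconn hp (by omega) hboff hcoff hbc h0 h1 hbx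
      (fun i hi hin => hi2 i hi (by omega)) hendx (cubic _ hd3 _ _ _ hcn.symm
        (hp.ne (by omega) (by omega) (by omega)) hcp (hp.adj (k + 2) (by omega)) hc ?_) hcx⟩
    exact hp.adj' (i := k + 2) (by omega) (by omega)

end Double

/-! ### Embedding the first two line graphs in 3-edge-colourable chorded paths. -/

section Labels

/-- To embed the line graph of `H` in `K`, label the edges `ij` of `H` with `i < j` injectively by
vertices of `K` so that adjacent edges get adjacent labels. -/
lemma lineGraph_isContained {α β : Type*} [LinearOrder α] {H : SimpleGraph α} {K : SimpleGraph β}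
    (l : α → α → β)
    (hinj : ∀ i j i' j', i < j → i' < j' → H.Adj i j → H.Adj i' j' → l i j = l i' j' →
      i = i' ∧ j = j')
    (hleft : ∀ i j j', i < j → j < j' → H.Adj i j → H.Adj i j' → K.Adj (l i j) (l i j'))
    (hright : ∀ i i' j, i < i' → i' < j → H.Adj i j → H.Adj i' j → K.Adj (l i j) (l i' j))
    (hmid : ∀ i j k, i < j → j < k → H.Adj i j → H.Adj j k → K.Adj (l i j) (l j k)) :
    H.lineGraph ⊑ K := by
  have hlt : ∀ e : H.edgeSet, ∃ i j, ∃ h : H.Adj i j, i < j ∧ e = ⟨s(i, j), h⟩ := by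
    rintro ⟨e, he⟩
    induction e with | _ i j
    have h : H.Adj i j := he
    rcases lt_or_gt_of_ne h.ne with hij | hij
    · exact ⟨i, j, h, hij, rfl⟩
    · exact ⟨j, i, h.symm, hij, Subtype.ext Sym2.eq_swap⟩
  let f : H.edgeSet → β := fun e => l e.1.inf e.1.sup
  have hf : ∀ i j (h : H.Adj i j), i < j → f ⟨s(i, j), h⟩ = l i j := fun i j h hij => by
    simp [f, hij.le]
  refine ⟨⟨⟨f, ?_⟩, ?_⟩⟩
  · intro e e' hee'
    obtain ⟨i, j, h, hij, rfl⟩ := hlt e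
    obtain ⟨i', j', h', hij', rfl⟩ := hlt e'
    rw [hf _ _ _ hij, hf _ _ _ hij']
    obtain ⟨hne, v, hv, hv'⟩ := lineGraph_adj_iff_exists.1 hee'
    rcases Sym2.mem_iff.1 hv with rfl | rfl <;> rcases Sym2.mem_iff.1 hv' with rfl | rfl
    · rcases lt_trichotomy j j' with hj | rfl | hj
      · exact hleft _ _ _ hij hj h h'
      · exact absurd rfl hne
      · exact (hleft _ _ _ hij' hj h' h).symm
    · exact (hmid _ _ _ hij' hij h' h).symm
    · exact hmid _ _ _ hij hij' h h'
    · rcases lt_trichotomy i i' with hi | rfl | hi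
      · exact hright _ _ _ hi hij' h h'
      · exact absurd rfl hne
      · exact (hright _ _ _ hi hij h' h).symm
  · intro e e' hee'
    change f e = f e' at hee'
    obtain ⟨i, j, h, hij, rfl⟩ := hlt e
    obtain ⟨i', j', h', hij', rfl⟩ := hlt e'
    rw [hf _ _ _ hij, hf _ _ _ hij'] at hee'
    obtain ⟨rfl, rfl⟩ := hinj i j i' j' hij hij' h h' hee'
    rfl

/-- A graph on the natural numbers in which every vertex has at most one neighbour that is not
consecutive to it is 3-edge-colourable. -/
lemma edgeColorable_three_of_chords {H : SimpleGraph ℕ}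
    (h : ∀ x y z, H.Adj x y → H.Adj x z → x + 1 ≠ y → y + 1 ≠ x → x + 1 ≠ z → z + 1 ≠ x → y = z) :
    EdgeColorable H 3 := by
  refine edgeColorable_of_symm
    -- Consecutive edges alternate between colours 0 and 1 by parity; the chords form a matching and
    -- take colour 2.
    (fun x y => if x + 1 = y ∨ y + 1 = x then (if min x y % 2 = 0 then 0 else 1) else 2) ?_ ?_
  · intro x y
    simp only [or_comm, min_comm]
  · intro x y z hxy hxz hyz
    have hx := hxy.ne
    have hx' := hxz.ne
    have := h x y z hxy hxz
    split_ifs <;> first | decide | (exfalso; omega)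

/-- The double star with subdivided middle edge, as a path with two chords: the leaves `0` and `1`
at `2` and the leaves `N - 1` and `N` at `N - 2`. -/
def chordedPathA (N : ℕ) : SimpleGraph ℕ := SimpleGraph.fromRel fun i j =>
  (j = i + 1 ∧ 1 ≤ i ∧ j + 1 ≤ N) ∨ (i = 0 ∧ j = 2) ∨ (i + 2 = N ∧ j = N)

/-- Two triangles joined by a path. -/
def chordedPathB (M : ℕ) : SimpleGraph ℕ := SimpleGraph.fromRel fun i j =>
  (j = i + 1 ∧ j ≤ M) ∨ (i = 0 ∧ j = 2) ∨ (i + 2 = M ∧ j = M)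

/-- Two copies of `K₄` minus an edge joined by a path. -/
def chordedPathC (Q : ℕ) : SimpleGraph ℕ := SimpleGraph.fromRel fun i j =>
  j = i + 1 ∨ (i = 0 ∧ j = 2) ∨ (i = 1 ∧ j = 3) ∨ (i + 2 = Q ∧ j = Q) ∨ (i + 3 = Q ∧ j + 1 = Q)

lemma edgeColorable_chordedPathB {M : ℕ} (hM : 6 ≤ M) : EdgeColorable (chordedPathB M) 3 := by
  refine edgeColorable_three_of_chords fun x y z hxy hxz _ _ _ _ => ?_
  simp only [chordedPathB, fromRel_adj] at hxy hxz
  omega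

/-- `7 ≤ Q` keeps the chords at the two ends disjoint: `3 < Q - 3`. For the double star `Q = k + 5`,
so this is where at least two subdivisions are needed. -/
lemma edgeColorable_chordedPathC {Q : ℕ} (hQ : 7 ≤ Q) : EdgeColorable (chordedPathC Q) 3 := by
  refine edgeColorable_three_of_chords fun x y z hxy hxz _ _ _ _ => ?_
  simp only [chordedPathC, fromRel_adj] at hxy hxz
  omega

/-- A path edge is labelled by its smaller end, and the two chords take the free labels `0` and `M`;
the three edges at each branch vertex become a triangle. -/
lemma lineGraph_chordedPathA {M : ℕ} (hM : 6 ≤ M) :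
    (chordedPathA (M + 1)).lineGraph ⊑ chordedPathB M := by
  let l : ℕ → ℕ → ℕ := fun i j => if i = 0 then 0 else if j = M + 1 then M else i
  have hl : ∀ i j, i < j → (chordedPathA (M + 1)).Adj i j →
      (j = i + 1 ∧ 1 ≤ i ∧ j ≤ M ∧ l i j = i) ∨ (i = 0 ∧ j = 2 ∧ l i j = 0) ∨
        (i + 1 = M ∧ j = M + 1 ∧ l i j = M) := by
    intro i j hij h
    simp only [chordedPathA, fromRel_adj] at h
    simp only [l]
    split_ifs <;> omega
  refine lineGraph_isContained l ?_ ?_ ?_ ?_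
  · intro i j i' j' hij hij' h h'
    rcases hl i j hij h with h | h | h <;> rcases hl i' j' hij' h' with h' | h' | h' <;> omega
  · intro i j j' hij hij' h h'
    simp only [chordedPathB, fromRel_adj]
    rcases hl i j (by omega) h with h | h | h <;> rcases hl i j' (by omega) h' with h' | h' | h' <;> omega
  · intro i i' j hij hij' h h'
    simp only [chordedPathB, fromRel_adj]
    rcases hl i j (by omega) h with h | h | h <;> rcases hl i' j (by omega) h' with h' | h' | h' <;> omega
  · intro i j k hij hij' h h'
    simp only [chordedPathB, fromRel_adj]
    rcases hl i j (by omega) h with h | h | h <;> rcases hl j k (by omega) h' with h' | h' | h' <;> omega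

/-- Edges are numbered along the path. The first chord is inserted as `2`, shifting later edges by
one; the second is inserted as `M - 1`, shifting the last two edges by two. -/
lemma lineGraph_chordedPathB {M : ℕ} (hM : 6 ≤ M) :
    (chordedPathB M).lineGraph ⊑ chordedPathC (M + 1) := by
  let l : ℕ → ℕ → ℕ := fun i j => if j = i + 2 then (if i = 0 then 2 else M - 1)
    else if i ≤ 1 then i else if i + 3 ≤ M then i + 1 else i + 2
  have hl : ∀ i j, i < j → (chordedPathB M).Adj i j →
      (j = i + 1 ∧ i ≤ 1 ∧ l i j = i) ∨ (j = i + 1 ∧ 2 ≤ i ∧ i + 3 ≤ M ∧ l i j = i + 1) ∨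
        (j = i + 1 ∧ M ≤ i + 2 ∧ j ≤ M ∧ l i j = i + 2) ∨ (i = 0 ∧ j = 2 ∧ l i j = 2) ∨
        (i + 2 = M ∧ j = M ∧ l i j + 1 = M) := by
    intro i j hij h
    simp only [chordedPathB, fromRel_adj] at h
    simp only [l]
    split_ifs <;> omega
  refine lineGraph_isContained l ?_ ?_ ?_ ?_
  · intro i j i' j' hij hij' h h'
    rcases hl i j hij h with h | h | h | h | h <;>
      rcases hl i' j' hij' h' with h' | h' | h' | h' | h' <;> omega
  · intro i j j' hij hij' h h'
    simp only [chordedPathC, fromRel_adj]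
    rcases hl i j (by omega) h with h | h | h | h | h <;> rcases hl i j' (by omega) h' with h' | h' | h' | h' | h' <;> omega
  · intro i i' j hij hij' h h'
    simp only [chordedPathC, fromRel_adj]
    rcases hl i j (by omega) h with h | h | h | h | h <;> rcases hl i' j (by omega) h' with h' | h' | h' | h' | h' <;> omega
  · intro i j k hij hij' h h'
    simp only [chordedPathC, fromRel_adj]
    rcases hl i j (by omega) h with h | h | h | h | h <;> rcases hl j k (by omega) h' with h' | h' | h' | h' | h' <;> omega

variable {V : Type u} {G : SimpleGraph V}

lemma edgeColorable_lineGraphs_of_chordedPathA {M : ℕ} (hM : 6 ≤ M)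
    (h : G ⊑ chordedPathA (M + 1)) :
    EdgeColorable G.lineGraph 3 ∧ EdgeColorable G.lineGraph.lineGraph 3 := by
  have h1 : G.lineGraph ⊑ chordedPathB M := h.lineGraph.trans (lineGraph_chordedPathA hM)
  exact ⟨(edgeColorable_chordedPathB hM).of_isContained h1,
    (edgeColorable_chordedPathC (by omega)).of_isContained
      (h1.lineGraph.trans (lineGraph_chordedPathB hM))⟩

lemma isContained_of_forall {W W' : Type*} {H : SimpleGraph W} {K : SimpleGraph W'} (f : W → W')
    (hf : Function.Injective f) (hadj : ∀ x y, H.Adj x y → K.Adj (f x) (f y)) : H ⊑ K :=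
  ⟨⟨⟨f, hadj _ _⟩, hf⟩⟩

lemma fin_three_eq_of_ne {i₀ i₁ : Fin 3} (h : i₀ ≠ i₁) (i j : Fin 3) :
    i ≠ i₀ → i ≠ i₁ → j ≠ i₀ → j ≠ i₁ → i = j := by
  revert i₀ i₁ i j
  decide

lemma IsTypeA.isContained (h : IsTypeA G) : ∃ M, 6 ≤ M ∧ G ⊑ chordedPathA (M + 1) := by
  obtain ⟨a, ⟨e⟩, hcard⟩ := h
  rw [ncard_clawSubdivision_leaves] at hcard
  obtain ⟨i₀, i₁, hne, hs⟩ := Set.ncard_eq_two.1 hcard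
  have h0 : a i₀ = 0 := by
    have : i₀ ∈ {i | a i = 0} := by rw [hs]; simp
    exact this
  have h1 : a i₁ = 0 := by
    have : i₁ ∈ {i | a i = 0} := by rw [hs]; simp
    exact this
  have h2 := fin_three_eq_of_ne hne
  let f : Option ((i : Fin 3) × Fin (a i + 1)) → ℕ := fun x => match x with
    | none => 2
    | some ⟨i, j⟩ => if i = i₀ then 0 else if i = i₁ then 1 else 3 + j
  have hf0 : ∀ i j, i = i₀ → f (some ⟨i, j⟩) = 0 := fun i j h => if_pos h
  have hf1 : ∀ i j, i = i₁ → f (some ⟨i, j⟩) = 1 := fun i j h => by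
    simp only [f]
    rw [if_neg (h ▸ hne.symm), if_pos h]
  have hf2 : ∀ i j, i ≠ i₀ → i ≠ i₁ → f (some ⟨i, j⟩) = 3 + j := fun i j h h' => by
    simp only [f]
    rw [if_neg h, if_neg h']
  have hcase : ∀ i (j : Fin (a i + 1)), (i = i₀ ∧ j.val = 0 ∧ f (some ⟨i, j⟩) = 0) ∨
      (i = i₁ ∧ j.val = 0 ∧ f (some ⟨i, j⟩) = 1) ∨
      (i ≠ i₀ ∧ i ≠ i₁ ∧ f (some ⟨i, j⟩) = 3 + j ∧ j.val ≤ a 0 + a 1 + a 2) := by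
    intro i j
    have hj := j.2
    by_cases hi0 : i = i₀
    · exact Or.inl ⟨hi0, by subst hi0; omega, hf0 i j hi0⟩
    by_cases hi1 : i = i₁
    · exact Or.inr (Or.inl ⟨hi1, by subst hi1; omega, hf1 i j hi1⟩)
    refine Or.inr (Or.inr ⟨hi0, hi1, hf2 i j hi0 hi1, ?_⟩)
    have : a i ≤ a 0 + a 1 + a 2 := by
      fin_cases i <;> simp <;> omega
    omega
  have hfn : f none = 2 := rfl
  -- Only an upper bound on the long leg is needed: the host may be longer, and its far end stays
  -- unused.
  refine ⟨a 0 + a 1 + a 2 + 10, by omega, IsContained.trans ⟨e.toCopy⟩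
    (isContained_of_forall f ?_ ?_)⟩
  · rintro (_ | ⟨i, m⟩) (_ | ⟨j, l⟩) h
    · rfl
    · rcases hcase j l with h' | h' | h' <;> omega
    · rcases hcase i m with h' | h' | h' <;> omega
    · have key : i = j ∧ m.val = l.val := by
        rcases hcase i m with ⟨hi, hm, hfi⟩ | ⟨hi, hm, hfi⟩ | ⟨hi, hi', hfi, -⟩ <;>
          rcases hcase j l with ⟨hj, hl, hfj⟩ | ⟨hj, hl, hfj⟩ | ⟨hj, hj', hfj, -⟩ <;>
          first
          | exact ⟨hi.trans hj.symm, by omega⟩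
          | exact ⟨h2 i j hi hi' hj hj', by omega⟩
          | (exfalso; omega)
      obtain ⟨rfl, h'⟩ := key
      rw [Fin.ext h']
  · have hnone : ∀ i (j : Fin (a i + 1)), j.val = 0 →
        (chordedPathA (a 0 + a 1 + a 2 + 10 + 1)).Adj 2 (f (some ⟨i, j⟩)) := by
      intro i j hj
      simp only [chordedPathA, fromRel_adj, and_true]
      rcases hcase i j with h' | h' | h' <;> omega
    rintro (_ | ⟨i, m⟩) (_ | ⟨j, l⟩) h
    · exact absurd rfl h.ne
    · exact hnone j l ((clawSubdivision_adj_none _).1 h)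
    · exact (hnone i m ((clawSubdivision_adj_none _).1 h.symm)).symm
    · obtain ⟨h3, h4⟩ := (clawSubdivision_adj_some _ _).1 h
      dsimp only at h3 h4
      subst h3
      simp only [chordedPathA, fromRel_adj]
      rcases hcase i m with ⟨hi, hm, hfi⟩ | ⟨hi, hm, hfi⟩ | ⟨hi, hi', hfi, hm⟩ <;>
        rcases hcase i l with ⟨hj, hl, hfj⟩ | ⟨hj, hl, hfj⟩ | ⟨hj, hj', hfj, hl⟩ <;>
        first
        | exact absurd (hi.symm.trans hj) hne
        | exact absurd (hj.symm.trans hi) hne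
        | exact absurd hi hj
        | exact absurd hj hi
        | exact absurd hj hi'
        | exact absurd hi hj'
        | omega

lemma subdivideEdge_isContained {k : ℕ} (hk : 2 ≤ k) :
    subdivideEdge doubleStar22 0 1 k ⊑ chordedPathA (k + 4 + 1) := by
  let f : Fin 6 ⊕ Fin k → ℕ := Sum.elim ![2, k + 3, 0, 1, k + 4, k + 5] (fun i => i + 3)
  have hcases : ∀ a : Fin 6, a = 0 ∧ f (Sum.inl a) = 2 ∨ a = 1 ∧ f (Sum.inl a) = k + 3 ∨
      a = 2 ∧ f (Sum.inl a) = 0 ∨ a = 3 ∧ f (Sum.inl a) = 1 ∨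
      a = 4 ∧ f (Sum.inl a) = k + 4 ∨ a = 5 ∧ f (Sum.inl a) = k + 5 := by
    intro a
    fin_cases a <;> simp [f]
  have hr : ∀ i, f (Sum.inr i) = i + 3 := fun _ => rfl
  refine isContained_of_forall f ?_ ?_
  · rintro (a | i) (b | j) h
    · congr 1
      rcases hcases a with h1 | h1 | h1 | h1 | h1 | h1 <;>
        rcases hcases b with h2 | h2 | h2 | h2 | h2 | h2 <;> omega
    · have := hr j
      have := j.2
      rcases hcases a with h1 | h1 | h1 | h1 | h1 | h1 <;> omega
    · have := hr i
      have := i.2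
      rcases hcases b with h1 | h1 | h1 | h1 | h1 | h1 <;> omega
    · have := hr i
      have := hr j
      congr 1
      exact Fin.ext (by omega)
  · have hlr : ∀ a i, (subdivideEdge doubleStar22 0 1 k).Adj (Sum.inl a) (Sum.inr i) →
        (chordedPathA (k + 4 + 1)).Adj (f (Sum.inl a)) (f (Sum.inr i)) := by
      intro a i h
      have := i.2
      rw [hr]
      rcases (subdivided_inl_inr a i).1 h with ⟨rfl, h'⟩ | ⟨rfl, h'⟩
      · simp only [chordedPathA, fromRel_adj, show f (Sum.inl 0) = 2 from rfl]
        omega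
      · simp only [chordedPathA, fromRel_adj, show f (Sum.inl 1) = k + 3 from rfl]
        omega
    rintro (a | i) (b | j) h
    · rcases (subdivided_inl_inl (by omega) a b).1 h with ⟨rfl, rfl | rfl⟩ | ⟨rfl, rfl | rfl⟩ |
        ⟨rfl, rfl | rfl⟩ | ⟨rfl, rfl | rfl⟩ <;> simp [chordedPathA, f]
    · exact hlr a j h
    · exact (hlr b i h.symm).symm
    · have := i.2
      have := j.2
      have := (subdivided_inr_inr i j).1 h
      rw [hr, hr]
      simp only [chordedPathA, fromRel_adj]
      omega

end Labels

/-! ### The line graphs of the star K_{1,4}. -/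

section Star
variable {V : Type u} {G : SimpleGraph V}

/-- The star with centre `0` on five vertices. -/
def starFive : SimpleGraph (Fin 5) where
  Adj x y := x ≠ y ∧ (x = 0 ∨ y = 0)
  symm := ⟨fun _ _ h => ⟨h.1.symm, h.2.symm⟩⟩
  loopless := ⟨fun _ h => h.1 rfl⟩

instance : DecidableRel starFive.Adj := fun x y =>
  inferInstanceAs (Decidable (x ≠ y ∧ (x = 0 ∨ y = 0)))

/-- The octahedron, with antipodal pairs `01`, `23`, `45`. -/
def octahedron : SimpleGraph (Fin 6) where
  Adj x y := x ≠ y ∧ x.val / 2 ≠ y.val / 2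
  symm := ⟨fun _ _ h => ⟨h.1.symm, h.2.symm⟩⟩
  loopless := ⟨fun _ h => h.1 rfl⟩

instance : DecidableRel octahedron.Adj := fun x y =>
  inferInstanceAs (Decidable (x ≠ y ∧ x.val / 2 ≠ y.val / 2))

/-- Moving to `Fin 5` provides the linear order that `lineGraph_isContained` requires and makes the
checks decidable. -/
lemma star_isContained : completeBipartiteGraph (Fin 1) (Fin 4) ⊑ starFive := by
  refine isContained_of_forall (Sum.elim (fun _ => 0) Fin.succ) ?_ ?_
  · decide
  · rintro (a | a) (b | b) h
    · simp at h
    · exact ⟨(Fin.succ_ne_zero b).symm, Or.inl rfl⟩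
    · exact ⟨Fin.succ_ne_zero a, Or.inr rfl⟩
    · simp at h

lemma lineGraph_starFive : starFive.lineGraph ⊑ (⊤ : SimpleGraph (Fin 4)) := by
  refine lineGraph_isContained (fun _ j => (![0, 0, 1, 2, 3] : Fin 5 → Fin 4) j) ?_ ?_ ?_ ?_ <;> decide

/-- Disjoint edges of K₄ receive antipodal labels: `01` and `23` get 0 and 1, `02` and `13` get 2
and 3, `03` and `12` get 4 and 5. -/
lemma lineGraph_top_four : (⊤ : SimpleGraph (Fin 4)).lineGraph ⊑ octahedron := by
  refine lineGraph_isContained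
    (fun i j => (![![0, 0, 2, 4], ![0, 0, 5, 3], ![0, 0, 0, 1], ![0, 0, 0, 0]] : Fin 4 → Fin 4 → Fin 6) i j) ?_ ?_ ?_ ?_ <;> decide

lemma edgeColorable_top_four : EdgeColorable (⊤ : SimpleGraph (Fin 4)) 4 := by
  refine edgeColorable_of_symm (fun x y => x + y) ?_ ?_ <;> decide

lemma edgeColorable_octahedron : EdgeColorable octahedron 4 := by
  refine edgeColorable_of_symm (fun x y => (![![0, 0, 0, 1, 2, 3], ![0, 0, 3, 2, 0, 1],
    ![0, 3, 0, 0, 1, 2], ![1, 2, 0, 0, 3, 0], ![2, 0, 1, 3, 0, 0], ![3, 1, 2, 0, 0, 0]] :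
    Fin 6 → Fin 6 → Fin 4) x y) ?_ ?_ <;> decide

lemma edgeColorable_lineGraphs_star (e : G ≃g completeBipartiteGraph (Fin 1) (Fin 4)) :
    EdgeColorable G.lineGraph 4 ∧ EdgeColorable G.lineGraph.lineGraph 4 := by
  have h : G ⊑ starFive := IsContained.trans ⟨e.toCopy⟩ star_isContained
  have h1 := h.lineGraph.trans lineGraph_starFive
  exact ⟨edgeColorable_top_four.of_isContained h1,
    edgeColorable_octahedron.of_isContained (h1.lineGraph.trans lineGraph_top_four)⟩

end Star

/-! ### The star K_{1,4} is prolific and has index three. -/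

section StarDegrees
variable {V : Type u} {G : SimpleGraph V}

lemma deg_iso {W : Type*} {H : SimpleGraph W} (e : G ≃g H) (v : V) : deg H (e v) = deg G v :=
  (Nat.card_congr (e.mapNeighborSet v)).symm

lemma deg_star_center (n : ℕ) :
    deg (completeBipartiteGraph (Fin 1) (Fin n)) (Sum.inl 0) = n := by
  have : (completeBipartiteGraph (Fin 1) (Fin n)).neighborSet (Sum.inl 0) = Set.range Sum.inr := by
    ext (x | x) <;> simp
  rw [deg, this, ← Set.image_univ, Set.ncard_image_of_injective _ Sum.inr_injective]
  simp

lemma deg_star_leaf {n : ℕ} (i : Fin n) :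
    deg (completeBipartiteGraph (Fin 1) (Fin n)) (Sum.inr i) = 1 := by
  have : (completeBipartiteGraph (Fin 1) (Fin n)).neighborSet (Sum.inr i) = {Sum.inl 0} := by
    ext (x | x)
    · simp [Subsingleton.elim x 0]
    · simp
  rw [deg, this, Set.ncard_singleton]

lemma edgeColorable_starFive : EdgeColorable starFive 4 := by
  refine edgeColorable_of_symm (fun x y => (![0, 0, 1, 2, 3] : Fin 5 → Fin 4) (max x y)) ?_ ?_ <;>
    decide

lemma ind_star_le (e : G ≃g completeBipartiteGraph (Fin 1) (Fin 4)) :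
    ind (fun _ H => chromaticIndex H) G ≤ 3 := by
  have : Finite V := Finite.of_equiv _ e.toEquiv.symm
  have hcol : EdgeColorable G 4 :=
    edgeColorable_starFive.of_isContained (IsContained.trans ⟨e.toCopy⟩ star_isContained)
  have hu : deg G (e.symm (Sum.inl 0)) = 4 := (deg_iso e.symm _).trans (deg_star_center 4)
  have hl : ∀ i, deg G (e.symm (Sum.inr i)) = 1 := fun i =>
    (deg_iso e.symm _).trans (deg_star_leaf i)
  have hadj : ∀ i, G.Adj (e.symm (Sum.inl 0)) (e.symm (Sum.inr i)) := fun i =>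
    e.symm.map_adj_iff.2 (by simp)
  have hne : ∀ i j, i ≠ j → e.symm (Sum.inr i) ≠ e.symm (Sum.inr j) := fun i j h h' =>
    h (Sum.inr_injective (e.symm.injective h'))
  -- Four colours suffice for G, and 4 + 14 = 18 < 20 = 2 + 4·4 + 1 + 1.
  exact ind_le_three hcol (hadj 0) (hadj 1) (hadj 2) (hne _ _ (by decide)) (hne _ _ (by decide))
    (hne _ _ (by decide)) (by rw [hu, hl, hl, hl]; norm_num)

lemma three_le_ind_star (e : G ≃g completeBipartiteGraph (Fin 1) (Fin 4)) :
    3 ≤ ind (fun _ H => chromaticIndex H) G := by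
  obtain ⟨h1, h2⟩ := edgeColorable_lineGraphs_star e
  refine three_le_ind (k := 4) ?_ h1 h2
  have hu : deg G (e.symm (Sum.inl 0)) = 4 := (deg_iso e.symm _).trans (deg_star_center 4)
  rw [← hu]
  exact deg_le_chromaticIndex _

/-- A vertex adjacent to all others rules out the path and the cycle on five vertices; counting
vertices rules out the claw and all other lengths. -/
lemma isProlific_star (e : G ≃g completeBipartiteGraph (Fin 1) (Fin 4)) : IsProlific G := by
  have hcard : Nat.card V = 5 := by
    rw [Nat.card_congr e.toEquiv]
    simp
  have huniv : ∀ v, v ≠ e.symm (Sum.inl 0) → G.Adj (e.symm (Sum.inl 0)) v := by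
    intro v hv
    rw [← e.symm_apply_apply v] at hv ⊢
    rw [e.symm.map_adj_iff]
    generalize e v = w at hv ⊢
    rcases w with w | w
    · exact absurd (by rw [Subsingleton.elim w 0]) hv
    · simp
  -- in a graph isomorphic to `G` some vertex is adjacent to all others
  have hdom : ∀ {W : Type} (H : SimpleGraph W), (G ≃g H) → ∃ w, ∀ x, x ≠ w → H.Adj w x := by
    intro W H f
    refine ⟨f (e.symm (Sum.inl 0)), fun x hx => ?_⟩
    have := huniv (f.symm x) fun h => hx (by rw [← h, RelIso.apply_symm_apply])
    have h' := f.map_adj_iff.2 this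
    rwa [RelIso.apply_symm_apply] at h'
  refine ⟨Finite.of_equiv _ e.toEquiv.symm, ?_, fun n => ⟨fun f => ?_⟩, fun n _ => ⟨fun f => ?_⟩,
    ⟨fun f => ?_⟩⟩
  · rw [connected_iff]
    refine ⟨fun x y => ?_, ⟨e.symm (Sum.inl 0)⟩⟩
    have : ∀ x, G.Reachable (e.symm (Sum.inl 0)) x := fun x => by
      by_cases hx : x = e.symm (Sum.inl 0)
      · rw [hx]
      · exact (huniv x hx).reachable
    exact (this x).symm.trans (this y)
  · obtain rfl : n = 5 := by
      rw [← hcard, Nat.card_congr f.toEquiv]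
      simp
    obtain ⟨w, hw⟩ := hdom _ f
    simp only [pathGraph_adj] at hw
    revert w
    decide
  · obtain rfl : n = 5 := by
      rw [← hcard, Nat.card_congr f.toEquiv]
      simp
    obtain ⟨w, hw⟩ := hdom _ f
    simp only [cycleGraph_adj] at hw
    revert w
    decide
  · have := Nat.card_congr f.toEquiv
    rw [hcard] at this
    simp at this

end StarDegrees

/-! ### Assembly of the theorem. -/

lemma exists_isProlific_star : ∃ (V : Type u) (G : SimpleGraph V), IsProlific G ∧
    ind (fun _ H => chromaticIndex H) G = 3 := by
  -- Lifting the vertex type provides a witness in every universe, so that the supremum over the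
  -- family is attained.
  have e := Iso.comap (Equiv.ulift.{u}) (completeBipartiteGraph (Fin 1) (Fin 4))
  exact ⟨_, _, isProlific_star e, le_antisymm (ind_star_le e) (three_le_ind_star e)⟩

lemma IsProlific.ind_le_three {V : Type u} {G : SimpleGraph V} (hG : IsProlific G) :
    ind (fun _ H => chromaticIndex H) G ≤ 3 := by
  have := hG.finite
  obtain ⟨p, hp⟩ := hG.exists_three_le_deg
  rcases ind_le_two_or hG.connected hp with h | ⟨⟨e⟩⟩ | h
  · exact h.trans (by norm_num)
  · exact ind_star_le e
  · exact h.ind_le_three hG.connected hG.not_claw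

lemma IsProlific.ind_eq_three_iff {V : Type u} {G : SimpleGraph V} (hG : IsProlific G) :
    ind (fun _ H => chromaticIndex H) G = 3 ↔
      Nonempty (G ≃g completeBipartiteGraph (Fin 1) (Fin 4)) ∨ IsTypeA G ∨
        ∃ k : ℕ, 2 ≤ k ∧ Nonempty (G ≃g subdivideEdge doubleStar22 0 1 k) := by
  have := hG.finite
  obtain ⟨p, hp⟩ := hG.exists_three_le_deg
  constructor
  · intro h3
    rcases ind_le_two_or hG.connected hp with h | h | h
    · rw [h3] at h
      exact absurd h (by norm_num)
    · exact Or.inl h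
    · exact Or.inr (h.classification hG.connected hG.not_claw)
  · intro h
    refine le_antisymm hG.ind_le_three ?_
    have hchi : ((3 : ℕ) : ℕ∞) ≤ chromaticIndex G :=
      le_trans (by exact_mod_cast hp) (deg_le_chromaticIndex p)
    obtain ⟨⟨e⟩⟩ | h := h
    · exact three_le_ind_star e
    obtain ⟨M, hM, hc⟩ : ∃ M, 6 ≤ M ∧ G ⊑ chordedPathA (M + 1) := by
      rcases h with h | ⟨k, hk, ⟨e⟩⟩
      · exact h.isContained
      · exact ⟨k + 4, by omega, IsContained.trans ⟨e.toCopy⟩ (subdivideEdge_isContained hk)⟩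
    obtain ⟨h1, h2⟩ := edgeColorable_lineGraphs_of_chordedPathA hM hc
    exact three_le_ind hchi h1 h2

end LineGraphIndex

theorem theoremI :
    (∀ (V : Type u) (G : SimpleGraph V), LineGraphIndex.IsProlific G →
      LineGraphIndex.ind (fun _ H => LineGraphIndex.chromaticIndex H) G ≤ 3 ∧
      (LineGraphIndex.ind (fun _ H => LineGraphIndex.chromaticIndex H) G = 3 ↔
        Nonempty (G ≃g completeBipartiteGraph (Fin 1) (Fin 4)) ∨
        LineGraphIndex.IsTypeA G ∨
        ∃ k : ℕ, 2 ≤ k ∧ Nonempty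
          (G ≃g LineGraphIndex.subdivideEdge LineGraphIndex.doubleStar22 0 1 k))) ∧
    LineGraphIndex.familyIndex.{u} (fun _ H => LineGraphIndex.chromaticIndex H)
      (fun _ H => LineGraphIndex.IsProlific H) = 3 := by
  refine ⟨fun V G hG => ⟨hG.ind_le_three, hG.ind_eq_three_iff⟩, le_antisymm ?_ ?_⟩
  · exact iSup_le fun W => iSup₂_le fun H hH => hH.ind_le_three
  · obtain ⟨V, G, hG, h3⟩ := LineGraphIndex.exists_isProlific_star.{u}
    rw [← h3]
    exact le_iSup_of_le V (le_iSup₂_of_le G hG le_rfl)
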